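/- Let $(p_n)_{n\ge 1}$ be positive integers such that $\lim_{n\to\infty}\frac{\log n}{\sqrt{p_n}}=\alpha\in[0,\infty)$. For each $n\ge 2$ let $\mathbf X_1,\dots,\mathbf X_n$ (depending on $n$) be independent random points, each uniformly distributed on the unit sphere $\mathbb S^{p_n-1}\subset\mathbb R^{p_n}$, let $\Theta_{ij}\in[0,\pi]$ be the angle between the vectors $\mathbf X_i$ and $\mathbf X_j$, and put $\Theta_{\min}=\min_{1\le i<j\le n}\Theta_{ij}$, $\Theta_{\max}=\max_{1\le i<j\le n}\Theta_{ij}$. Then, as $n\to\infty$, $$p_n\cos^2\Theta_{\min}-4\log n+\log\log n$$ converges weakly to the probability distribution on $\mathbb R$ with cumulative distribution function $$\exp\Big\{-\frac{1}{4\sqrt{2\pi}}\,e^{-(y+8\alpha^2)/2}\Big\},\qquad y\in\mathbb R.$$ The conclusion still holds if $\Theta_{\min}$ is replaced by $\Theta_{\max}$. -/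

import Mathlib

open MeasureTheory ProbabilityTheory Filter Topology

/-- The unit sphere `S^{d-1}` in the Euclidean space `ℝ^d`. -/
abbrev UnitSphere (d : ℕ) : Type :=
  Metric.sphere (0 : EuclideanSpace ℝ (Fin d)) 1

/-- The uniform distribution on `S^{d-1}`: normalized surface measure. -/
noncomputable def uniformSphere (d : ℕ) : Measure (UnitSphere d) :=
  ((volume : Measure (EuclideanSpace ℝ (Fin d))).toSphere Set.univ)⁻¹ •
    (volume : Measure (EuclideanSpace ℝ (Fin d))).toSphere

theorem isProbabilityMeasure_uniformSphere (d : ℕ) (hd : 1 ≤ d) :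
    IsProbabilityMeasure (uniformSphere d) := by
  constructor
  have : Nonempty (Fin d) := ⟨⟨0, hd⟩⟩
  have h0 : (volume : Measure (EuclideanSpace ℝ (Fin d))).toSphere Set.univ ≠ 0 := by
    rw [Ne, Measure.measure_univ_eq_zero]
    exact Measure.toSphere_ne_zero _
  simp only [uniformSphere, Measure.smul_apply, smul_eq_mul]
  exact ENNReal.inv_mul_cancel h0 (measure_ne_top _ _)

/-- The angle in `[0, π]` between the unit vectors `x i` and `x j`. -/
noncomputable def pairAngle {d n : ℕ} (x : Fin n → UnitSphere d) (i j : Fin n) : ℝ :=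
  InnerProductGeometry.angle (x i : EuclideanSpace ℝ (Fin d)) (x j)

/-- The smallest angle over all pairs `i < j` (a minimum over a finite nonempty set if `2 ≤ n`). -/
noncomputable def minAngle {d n : ℕ} (x : Fin n → UnitSphere d) : ℝ :=
  ⨅ q : {q : Fin n × Fin n // q.1 < q.2}, pairAngle x q.1.1 q.1.2

/-- The largest angle over all pairs `i < j` (a maximum over a finite nonempty set if `2 ≤ n`). -/
noncomputable def maxAngle {d n : ℕ} (x : Fin n → UnitSphere d) : ℝ :=
  ⨆ q : {q : Fin n × Fin n // q.1 < q.2}, pairAngle x q.1.1 q.1.2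

open scoped Pointwise ENNReal

/-! Cosine decreases on `[0, π]`, so `cos Θ_min` is the largest inner product over pairs and `-cos
Θ_max` the largest negated one; a sign `ε = ±1` treats both at once. Put `a = 4 log n - log log n +
y` and `t = √(a / p)`. Once `a > 0`, the statistic is at most `y` exactly when the maximum `C`
satisfies `|C| ≤ t`. The event `C < -t` is asymptotically negligible, so it suffices to find the
limit of the probability that no pair exceeds `t`.

Let `r` be the probability of the cap at height `t`. It does not depend on the centre, so two pair
events sharing one point are still independent. A Stein–Chen type bound
(`abs_measure_no_related_pair_sub_exp_le`) then gives `exp (-n(n-1)r/2)` with error `O(n³ r²)`. If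
`n² r / 2` converges, this error is `O(1/n)`.

To find `r`, split the space as `ℝ × E`: the slope `v = s / ‖y‖` of a uniform point has density
proportional to `(1 + v²)^(-p/2)` (`uniformSphere_cap`). Mills-type tail bounds and a Gaussian limit
for the normalising constant give `r ~ (1 - a/p)^((p-1)/2) / √(2πa)`. Since `a²/p → 16α²`, the
second-order term of `log (1 - a/p)` contributes `e^(-4α²)`, while `n² e^(-a/2) / √a → e^(-y/2) /
2`. Hence `n² r / 2` tends to `e^(-(y + 8α²)/2) / (4√(2π))`. -/

/-! ### Spherical caps as integrals over the slope -/

theorem uniformSphere_apply {d : ℕ} (hd : 1 ≤ d) {s : Set (UnitSphere d)} (hs : MeasurableSet s) :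
    uniformSphere d s =
      volume (Set.Ioo (0 : ℝ) 1 • ((↑) '' s) : Set (EuclideanSpace ℝ (Fin d))) /
        volume (Metric.ball (0 : EuclideanSpace ℝ (Fin d)) 1) := by
  have : Nonempty (Fin d) := ⟨⟨0, hd⟩⟩
  have hd0 : (d : ℝ≥0∞) ≠ 0 := by exact_mod_cast (show d ≠ 0 by omega)
  have hb : volume (Metric.ball (0 : EuclideanSpace ℝ (Fin d)) 1) ≠ 0 :=
    (Metric.measure_ball_pos _ _ one_pos).ne'
  simp only [uniformSphere, Measure.smul_apply, smul_eq_mul]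
  rw [Measure.toSphere_apply' _ hs, Measure.toSphere_apply_univ, finrank_euclideanSpace,
    Fintype.card_fin, ← ENNReal.div_eq_inv_mul]
  exact ENNReal.mul_div_mul_left _ _ hd0 (ENNReal.natCast_ne_top d)

theorem Ioo_smul_cap {E : Type*} [NormedAddCommGroup E] [InnerProductSpace ℝ E] (x : E) (t : ℝ) :
    (Set.Ioo (0 : ℝ) 1 •
      ((↑) '' {y : Metric.sphere (0 : E) 1 | t < inner ℝ x (y : E)}) : Set E) =
    {z | z ≠ 0 ∧ ‖z‖ < 1 ∧ t * ‖z‖ < inner ℝ x z} := by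
  ext z
  simp only [Set.mem_smul, Set.mem_image, Set.mem_ofPred_eq]
  constructor
  · rintro ⟨r, ⟨hr0, hr1⟩, _, ⟨y, hy, rfl⟩, rfl⟩
    have hn : ‖(y : E)‖ = 1 := by simp
    have hnz : ‖r • (y : E)‖ = r := by rw [norm_smul, hn, mul_one, Real.norm_of_nonneg hr0.le]
    refine ⟨fun h => ?_, by rwa [hnz], ?_⟩
    · rw [h, norm_zero] at hnz
      exact hr0.ne hnz
    · rw [hnz, inner_smul_right, mul_comm]
      exact mul_lt_mul_of_pos_left hy hr0
  · rintro ⟨h0, h1, h2⟩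
    have hz : 0 < ‖z‖ := norm_pos_iff.2 h0
    refine ⟨‖z‖, ⟨hz, h1⟩, ‖z‖⁻¹ • z, ⟨⟨‖z‖⁻¹ • z, ?_⟩, ?_, rfl⟩, ?_⟩
    · simp [norm_smul, hz.ne']
    · show t < inner ℝ x (‖z‖⁻¹ • z)
      rw [inner_smul_right, ← div_eq_inv_mul, lt_div_iff₀ hz]
      exact h2
    · rw [smul_smul, mul_inv_cancel₀ hz.ne', one_smul]

theorem lintegral_comp_smul_of_pos {E : Type*} [NormedAddCommGroup E] [NormedSpace ℝ E]
    [MeasurableSpace E] [BorelSpace E] [FiniteDimensional ℝ E] (μ : Measure E)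
    [μ.IsAddHaarMeasure] {f : E → ℝ≥0∞} (hf : Measurable f) {r : ℝ} (hr : 0 < r) :
    ∫⁻ x, f (r • x) ∂μ = ENNReal.ofReal ((r ^ Module.finrank ℝ E)⁻¹) * ∫⁻ x, f x ∂μ := by
  rw [← lintegral_map hf (measurable_const_smul r), Measure.map_addHaar_smul μ hr.ne',
    lintegral_smul_measure, abs_of_pos (by positivity), smul_eq_mul]

theorem measurableSet_slope_cone {E : Type*} [NormedAddCommGroup E] [MeasurableSpace E]
    [BorelSpace E] {V : Set ℝ} (hV : MeasurableSet V) :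
    MeasurableSet {q : ℝ × E | q.2 ≠ 0 ∧ q.1 ^ 2 + ‖q.2‖ ^ 2 < 1 ∧ q.1 / ‖q.2‖ ∈ V} := by
  have h1 : MeasurableSet {q : ℝ × E | q.2 ≠ 0} :=
    (measurable_snd (measurableSet_singleton (0 : E))).compl
  have h2 : MeasurableSet {q : ℝ × E | q.1 ^ 2 + ‖q.2‖ ^ 2 < 1} :=
    measurableSet_lt ((measurable_fst.pow_const 2).add (measurable_snd.norm.pow_const 2))
      measurable_const
  have h3 : MeasurableSet {q : ℝ × E | q.1 / ‖q.2‖ ∈ V} :=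
    (measurable_fst.div measurable_snd.norm) hV
  exact h1.inter (h2.inter h3)

/-- The volume of the part of the unit ball of `ℝ × E` where the slope `s / ‖y‖` lies in `V`. -/
theorem volume_slope_cone {E : Type*} [NormedAddCommGroup E] [InnerProductSpace ℝ E]
    [MeasurableSpace E] [BorelSpace E] [FiniteDimensional ℝ E] {V : Set ℝ} (hV : MeasurableSet V) :
    volume {q : ℝ × E | q.2 ≠ 0 ∧ q.1 ^ 2 + ‖q.2‖ ^ 2 < 1 ∧ q.1 / ‖q.2‖ ∈ V} =
      (∫⁻ v in V, ENNReal.ofReal ((√(1 + v ^ 2))⁻¹ ^ (Module.finrank ℝ E + 1))) *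
        ∫⁻ y : E, ENNReal.ofReal ‖y‖ * (Metric.ball (0 : E) 1).indicator 1 y := by
  rw [Measure.volume_eq_prod, Measure.prod_apply_symm (measurableSet_slope_cone hV)]
  have hslice : ∀ y : E, volume ((fun s : ℝ => (s, y)) ⁻¹'
      {q : ℝ × E | q.2 ≠ 0 ∧ q.1 ^ 2 + ‖q.2‖ ^ 2 < 1 ∧ q.1 / ‖q.2‖ ∈ V}) =
      ∫⁻ v in V, ENNReal.ofReal ‖y‖ *
        {q : ℝ × E | ‖√(1 + q.1 ^ 2) • q.2‖ < 1}.indicator 1 (v, y) := by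
    intro y
    by_cases hy : y = 0
    · simp [hy]
    have hy0 : 0 < ‖y‖ := norm_pos_iff.2 hy
    -- Substituting `s = ‖y‖ v` makes the slice a dilate of a set of slopes; its Jacobian is the
    -- weight `‖y‖`.
    have hset : ((fun s : ℝ => (s, y)) ⁻¹'
        {q : ℝ × E | q.2 ≠ 0 ∧ q.1 ^ 2 + ‖q.2‖ ^ 2 < 1 ∧ q.1 / ‖q.2‖ ∈ V}) =
        ‖y‖ • ({v : ℝ | ‖√(1 + v ^ 2) • y‖ < 1} ∩ V) := by
      ext s
      rw [Set.mem_smul_set_iff_inv_smul_mem₀ hy0.ne']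
      have h1 : ‖√(1 + (‖y‖⁻¹ * s) ^ 2) • y‖ ^ 2 = s ^ 2 + ‖y‖ ^ 2 := by
        rw [norm_smul, mul_pow, Real.norm_of_nonneg (Real.sqrt_nonneg _),
          Real.sq_sqrt (by positivity)]
        field_simp
        ring
      have h2 : ‖√(1 + (‖y‖⁻¹ * s) ^ 2) • y‖ < 1 ↔ s ^ 2 + ‖y‖ ^ 2 < 1 := by
        rw [← h1, sq_lt_one_iff₀ (norm_nonneg _)]
      simp only [Set.mem_preimage, Set.mem_ofPred_eq, Set.mem_inter_iff, smul_eq_mul, h2]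
      rw [div_eq_inv_mul]
      tauto
    rw [hset, Measure.addHaar_smul, Module.finrank_self, pow_one, abs_of_pos hy0,
      lintegral_const_mul' _ _ ENNReal.ofReal_ne_top]
    congr 1
    have hm : MeasurableSet {v : ℝ | ‖√(1 + v ^ 2) • y‖ < 1} :=
      measurableSet_lt (by fun_prop) measurable_const
    rw [← Measure.restrict_apply hm, ← lintegral_indicator_one hm]
    rfl
  simp_rw [hslice]
  have hm2 : MeasurableSet {q : ℝ × E | ‖√(1 + q.1 ^ 2) • q.2‖ < 1} :=
    measurableSet_lt (by fun_prop) measurable_const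
  rw [lintegral_lintegral_swap]
  · rw [← lintegral_mul_const _ (by fun_prop)]
    refine lintegral_congr fun v => ?_
    have hr : 0 < √(1 + v ^ 2) := Real.sqrt_pos.2 (by positivity)
    have hH : Measurable fun y : E =>
        ENNReal.ofReal ‖y‖ * (Metric.ball (0 : E) 1).indicator 1 y := by
      refine Measurable.mul (by fun_prop) ?_
      exact measurable_one.indicator Metric.isOpen_ball.measurableSet
    -- For fixed `v`, rescaling `y` by `√(1 + v²)` gives `finrank` powers from the Jacobian and one
    -- more from the weight `‖y‖`.
    rw [pow_succ', ENNReal.ofReal_mul (by positivity), mul_assoc, inv_pow,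
      ← lintegral_comp_smul_of_pos volume hH hr, ← lintegral_const_mul' _ _ ENNReal.ofReal_ne_top]
    refine lintegral_congr fun y => ?_
    rw [← mul_assoc, ← ENNReal.ofReal_mul (by positivity)]
    have hi : ({q : ℝ × E | ‖√(1 + q.1 ^ 2) • q.2‖ < 1}.indicator 1 (v, y) : ℝ≥0∞) =
        (Metric.ball (0 : E) 1).indicator 1 (√(1 + v ^ 2) • y) := by
      by_cases h : ‖√(1 + v ^ 2) • y‖ < 1
      · rw [Set.indicator_of_mem (by exact h), Set.indicator_of_mem (mem_ball_zero_iff.2 h)]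
        rfl
      · rw [Set.indicator_of_notMem (by exact h),
          Set.indicator_of_notMem (fun h' => h (mem_ball_zero_iff.1 h'))]
    rw [hi, norm_smul, Real.norm_of_nonneg hr.le, inv_mul_cancel_left₀ hr.ne']
  · refine Measurable.aemeasurable ?_
    refine Measurable.mul (by fun_prop) ?_
    have : Measurable (({q : ℝ × E | ‖√(1 + q.1 ^ 2) • q.2‖ < 1}.indicator
        (1 : ℝ × E → ℝ≥0∞)) ∘ Prod.swap) :=
      (measurable_one.indicator hm2).comp measurable_swap
    exact this

/-- Take any isometry and follow it by the reflection exchanging the image of `x` with `y`. This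
turns the axis of a cap into the first coordinate axis of `ℝ × E`. -/
theorem exists_linearIsometryEquiv_map_eq {E F : Type*} [NormedAddCommGroup E]
    [InnerProductSpace ℝ E] [FiniteDimensional ℝ E] [NormedAddCommGroup F]
    [InnerProductSpace ℝ F] [FiniteDimensional ℝ F]
    (h : Module.finrank ℝ E = Module.finrank ℝ F) {x : E} {y : F} (hxy : ‖x‖ = ‖y‖) :
    ∃ φ : E ≃ₗᵢ[ℝ] F, φ x = y := by
  let φ₀ : E ≃ₗᵢ[ℝ] F :=
    (stdOrthonormalBasis ℝ E).equiv (stdOrthonormalBasis ℝ F) (finCongr h)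
  refine ⟨φ₀.trans (ℝ ∙ (φ₀ x - y))ᗮ.reflection, ?_⟩
  exact Submodule.reflection_sub (by rw [φ₀.norm_map, hxy])

theorem mul_sqrt_lt_iff_slope {t s a : ℝ} (ht0 : 0 ≤ t) (ht1 : t < 1) (ha : 0 < a) :
    t * √(s ^ 2 + a ^ 2) < s ↔ t / √(1 - t ^ 2) < s / a := by
  have hu : 0 < 1 - t ^ 2 := by nlinarith
  have hu' : 0 < √(1 - t ^ 2) := Real.sqrt_pos.2 hu
  rw [div_lt_div_iff₀ hu' ha]
  rcases le_or_gt s 0 with hs | hs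
  · have h1 : 0 ≤ t * √(s ^ 2 + a ^ 2) := by positivity
    have h2 : s * √(1 - t ^ 2) ≤ 0 := mul_nonpos_of_nonpos_of_nonneg hs hu'.le
    have h3 : 0 ≤ t * a := by positivity
    constructor <;> intro h <;> linarith
  · have h1 : t * √(s ^ 2 + a ^ 2) < s ↔ t ^ 2 * (s ^ 2 + a ^ 2) < s ^ 2 := by
      rw [← sq_lt_sq₀ (by positivity) hs.le, mul_pow, Real.sq_sqrt (by positivity)]
    have h2 : t * a < s * √(1 - t ^ 2) ↔ t ^ 2 * a ^ 2 < s ^ 2 * (1 - t ^ 2) := by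
      rw [← sq_lt_sq₀ (by positivity) (by positivity), mul_pow, mul_pow, Real.sq_sqrt hu.le]
    rw [h1, h2]
    constructor <;> intro h <;> nlinarith

/-- The probability that a uniform point of `S^d` lies in the cap `{y | t < ⟪x, y⟫}`. -/
theorem uniformSphere_cap {d : ℕ} (hd : 1 ≤ d) (x : UnitSphere (d + 1)) {t : ℝ} (ht0 : 0 ≤ t)
    (ht1 : t < 1) :
    uniformSphere (d + 1) {y | t < inner ℝ (x : EuclideanSpace ℝ (Fin (d + 1))) y} =
      (∫⁻ v in Set.Ioi (t / √(1 - t ^ 2)),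
        ENNReal.ofReal ((√(1 + v ^ 2))⁻¹ ^ (d + 1))) /
      ∫⁻ v : ℝ, ENNReal.ofReal ((√(1 + v ^ 2))⁻¹ ^ (d + 1)) := by
  have : Nonempty (Fin d) := ⟨⟨0, hd⟩⟩
  have hms : MeasurableSet
      {y : UnitSphere (d + 1) | t < inner ℝ (x : EuclideanSpace ℝ (Fin (d + 1))) y} :=
    measurableSet_lt measurable_const (by fun_prop)
  rw [uniformSphere_apply (by omega) hms, Ioo_smul_cap]
  -- `K` is a factor of both the cone and the ball volumes, so it cancels unevaluated; only `K ≠ 0`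
  -- and `K ≠ ⊤` matter, and both follow from the ball having positive finite volume.
  set K := ∫⁻ y : EuclideanSpace ℝ (Fin d), ENNReal.ofReal ‖y‖ *
    (Metric.ball (0 : EuclideanSpace ℝ (Fin d)) 1).indicator 1 y with hK
  let e : WithLp 2 (ℝ × EuclideanSpace ℝ (Fin d)) := WithLp.toLp 2 (1, 0)
  have he : ‖e‖ = 1 := by
    have := WithLp.prod_norm_sq_eq_of_L2 e
    have h2 : ‖e‖ ^ 2 = 1 := by rw [this]; simp [e]
    exact (pow_eq_one_iff_of_nonneg (norm_nonneg e) two_ne_zero).1 h2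
  have hfr : Module.finrank ℝ (EuclideanSpace ℝ (Fin (d + 1))) =
      Module.finrank ℝ (WithLp 2 (ℝ × EuclideanSpace ℝ (Fin d))) := by
    rw [(WithLp.linearEquiv 2 ℝ (ℝ × EuclideanSpace ℝ (Fin d))).finrank_eq]
    simp [add_comm]
  obtain ⟨φ, hφ⟩ := exists_linearIsometryEquiv_map_eq hfr
    (x := (x : EuclideanSpace ℝ (Fin (d + 1)))) (y := e) (by rw [he]; simp)
  have hψ : MeasurePreserving
      (fun z : EuclideanSpace ℝ (Fin (d + 1)) => WithLp.ofLp (φ z)) volume volume :=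
    (WithLp.volume_preserving_ofLp ℝ (EuclideanSpace ℝ (Fin d))).comp φ.measurePreserving
  have hnorm : ∀ z, ‖z‖ ^ 2 = (WithLp.ofLp (φ z)).1 ^ 2 + ‖(WithLp.ofLp (φ z)).2‖ ^ 2 := by
    intro z
    rw [← φ.norm_map, WithLp.prod_norm_sq_eq_of_L2]
    simp
  have hinner : ∀ z, inner ℝ (x : EuclideanSpace ℝ (Fin (d + 1))) z = (WithLp.ofLp (φ z)).1 := by
    intro z
    rw [← φ.inner_map_map, hφ, WithLp.prod_inner_apply]
    simp [e]
  -- The axis, where the slope is undefined, is null because `d ≥ 1`.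
  have hae : ∀ᵐ z : EuclideanSpace ℝ (Fin (d + 1)), (WithLp.ofLp (φ z)).2 ≠ 0 := by
    have h0 : ∀ᵐ y : EuclideanSpace ℝ (Fin d), y ≠ 0 := by simp [ae_iff]
    exact (Measure.quasiMeasurePreserving_snd.comp hψ.quasiMeasurePreserving).ae h0
  have hcone : ∀ {V : Set ℝ}, MeasurableSet V →
      volume {z : EuclideanSpace ℝ (Fin (d + 1)) | (WithLp.ofLp (φ z)).2 ≠ 0 ∧ ‖z‖ < 1 ∧
        (WithLp.ofLp (φ z)).1 / ‖(WithLp.ofLp (φ z)).2‖ ∈ V} =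
      (∫⁻ v in V, ENNReal.ofReal ((√(1 + v ^ 2))⁻¹ ^ (d + 1))) * K := by
    intro V hV
    have h := volume_slope_cone (E := EuclideanSpace ℝ (Fin d)) hV
    rw [finrank_euclideanSpace, Fintype.card_fin] at h
    rw [hK, ← h, ← hψ.measure_preimage (measurableSet_slope_cone hV).nullMeasurableSet]
    congr 1
    ext z
    simp only [Set.mem_ofPred_eq, Set.mem_preimage, ← hnorm, sq_lt_one_iff₀ (norm_nonneg z)]
  have hcap : volume {z : EuclideanSpace ℝ (Fin (d + 1)) | z ≠ 0 ∧ ‖z‖ < 1 ∧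
      t * ‖z‖ < inner ℝ (x : EuclideanSpace ℝ (Fin (d + 1))) z} =
      (∫⁻ v in Set.Ioi (t / √(1 - t ^ 2)),
        ENNReal.ofReal ((√(1 + v ^ 2))⁻¹ ^ (d + 1))) * K := by
    rw [← hcone measurableSet_Ioi]
    refine measure_congr ?_
    filter_upwards [hae] with z hz
    refine propext ?_
    show (z ≠ 0 ∧ ‖z‖ < 1 ∧ _) ↔ (_ ∧ ‖z‖ < 1 ∧ _)
    have hz0 : z ≠ 0 := by rintro rfl; simp at hz
    have hnz : ‖z‖ = √((WithLp.ofLp (φ z)).1 ^ 2 + ‖(WithLp.ofLp (φ z)).2‖ ^ 2) := by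
      rw [← hnorm, Real.sqrt_sq (norm_nonneg z)]
    have := mul_sqrt_lt_iff_slope (s := (WithLp.ofLp (φ z)).1) ht0 ht1 (norm_pos_iff.2 hz)
    rw [← hnz] at this
    rw [hinner, this, Set.mem_Ioi]
    tauto
  have hball : volume (Metric.ball (0 : EuclideanSpace ℝ (Fin (d + 1))) 1) =
      (∫⁻ v : ℝ, ENNReal.ofReal ((√(1 + v ^ 2))⁻¹ ^ (d + 1))) * K := by
    rw [← setLIntegral_univ, ← hcone MeasurableSet.univ]
    refine measure_congr ?_
    filter_upwards [hae] with z hz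
    refine propext ?_
    show z ∈ Metric.ball _ _ ↔ (_ ∧ ‖z‖ < 1 ∧ _)
    rw [mem_ball_zero_iff]
    exact ⟨fun h => ⟨hz, h, trivial⟩, fun h => h.2.1⟩
  have hb0 : volume (Metric.ball (0 : EuclideanSpace ℝ (Fin (d + 1))) 1) ≠ 0 :=
    (Metric.measure_ball_pos _ _ one_pos).ne'
  have hbt : volume (Metric.ball (0 : EuclideanSpace ℝ (Fin (d + 1))) 1) ≠ ⊤ :=
    measure_ball_lt_top.ne
  have hI0 : (∫⁻ v : ℝ, ENNReal.ofReal ((√(1 + v ^ 2))⁻¹ ^ (d + 1))) ≠ 0 := fun h => by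
    rw [hball, h, zero_mul] at hb0; exact hb0 rfl
  have hK0 : K ≠ 0 := fun h => by rw [hball, h, mul_zero] at hb0; exact hb0 rfl
  have hKt : K ≠ ⊤ := fun h => by rw [hball, h, ENNReal.mul_top hI0] at hbt; exact hbt rfl
  rw [hcap, hball, ENNReal.mul_div_mul_right _ _ hK0 hKt]

/-! ### Normalisation and tail of the slope density -/

/-- The density `(1 + v²)^{-m/2}`, up to normalisation, of the slope of a uniform point of the
sphere `S^{m-1}`. -/
noncomputable def slopeDensity (m : ℕ) (v : ℝ) : ℝ := (√(1 + v ^ 2))⁻¹ ^ m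

theorem slopeDensity_pos (m : ℕ) (v : ℝ) : 0 < slopeDensity m v := by
  unfold slopeDensity
  positivity

theorem continuous_slopeDensity (m : ℕ) : Continuous (slopeDensity m) := by
  unfold slopeDensity
  refine (Continuous.inv₀ (by fun_prop) fun v => ?_).pow m
  positivity

theorem slopeDensity_le {m : ℕ} (hm : 2 ≤ m) (v : ℝ) : slopeDensity m v ≤ (1 + v ^ 2)⁻¹ := by
  unfold slopeDensity
  have h1 : (√(1 + v ^ 2))⁻¹ ≤ 1 := inv_le_one_of_one_le₀ (by
    rw [Real.one_le_sqrt]; nlinarith [sq_nonneg v])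
  calc _ ≤ (√(1 + v ^ 2))⁻¹ ^ 2 := pow_le_pow_of_le_one (by positivity) h1 hm
    _ = _ := by rw [inv_pow, Real.sq_sqrt (by positivity)]

theorem integrable_slopeDensity {m : ℕ} (hm : 2 ≤ m) : Integrable (slopeDensity m) :=
  integrable_inv_one_add_sq.mono' (continuous_slopeDensity m).aestronglyMeasurable
    (Eventually.of_forall fun v => by
      rw [Real.norm_of_nonneg (slopeDensity_pos m v).le]
      exact slopeDensity_le hm v)

theorem uniformSphere_real_cap {m : ℕ} (hm : 2 ≤ m) (x : UnitSphere m) {t : ℝ} (ht0 : 0 ≤ t)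
    (ht1 : t < 1) :
    (uniformSphere m).real {y | t < inner ℝ (x : EuclideanSpace ℝ (Fin m)) y} =
      (∫ v in Set.Ioi (t / √(1 - t ^ 2)), slopeDensity m v) / ∫ v, slopeDensity m v := by
  obtain ⟨d, rfl⟩ : ∃ d, m = d + 1 := ⟨m - 1, by omega⟩
  have hnn : ∀ v, 0 ≤ slopeDensity (d + 1) v := fun v => (slopeDensity_pos _ v).le
  rw [measureReal_def, uniformSphere_cap (by omega) x ht0 ht1, ENNReal.toReal_div,
    integral_eq_lintegral_of_nonneg_ae (Eventually.of_forall hnn)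
      (continuous_slopeDensity _).aestronglyMeasurable,
    integral_eq_lintegral_of_nonneg_ae (Eventually.of_forall hnn)
      (continuous_slopeDensity _).aestronglyMeasurable]
  rfl

theorem slopeDensity_div_sqrt (m : ℕ) (w : ℝ) :
    slopeDensity m (w / √m) = (√((1 + w ^ 2 / m) ^ m))⁻¹ := by
  unfold slopeDensity
  have hx : 0 ≤ 1 + w ^ 2 / (m : ℝ) := by positivity
  rw [div_pow, Real.sq_sqrt (Nat.cast_nonneg m), inv_pow,
    ← Real.sqrt_sq (pow_nonneg (Real.sqrt_nonneg (1 + w ^ 2 / (m : ℝ))) m), ← pow_mul, mul_comm,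
    pow_mul, Real.sq_sqrt hx]

/-- After the substitution `v = w / √m` the integrand is `(1 + w²/m)^(-m/2)`, which tends to
`e^(-w²/2)`; dominated convergence yields the Gaussian integral. -/
theorem tendsto_sqrt_mul_integral_slopeDensity :
    Tendsto (fun m : ℕ => √m * ∫ v, slopeDensity m v) atTop (𝓝 √(2 * Real.pi)) := by
  have hlim : ∫ w : ℝ, Real.exp (-(1 / 2) * w ^ 2) = √(2 * Real.pi) := by
    rw [integral_gaussian]
    congr 1
    ring
  have hscale : ∀ᶠ m : ℕ in atTop,
      ∫ w, slopeDensity m (w / √m) = √m * ∫ v, slopeDensity m v := by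
    filter_upwards with m
    rw [Measure.integral_comp_div, abs_of_nonneg (Real.sqrt_nonneg _), smul_eq_mul]
  rw [← hlim]
  refine Tendsto.congr' hscale ?_
  refine tendsto_integral_filter_of_dominated_convergence (fun w => 2 * (1 + w ^ 2)⁻¹) ?_ ?_
    (integrable_inv_one_add_sq.const_mul 2) ?_
  · filter_upwards with m
    exact ((continuous_slopeDensity m).comp (continuous_id.div_const _)).aestronglyMeasurable
  · filter_upwards [eventually_ge_atTop 2] with m hm
    filter_upwards with w
    have hm0 : (0 : ℝ) < m := by positivity
    have hm2 : (2 : ℝ) ≤ m := by exact_mod_cast hm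
    rw [Real.norm_of_nonneg (slopeDensity_pos _ _).le, slopeDensity_div_sqrt,
      Real.sqrt_eq_rpow, ← Real.rpow_natCast, ← Real.rpow_mul (by positivity)]
    -- Bernoulli's inequality with exponent `m / 2 ≥ 1` supplies a dominating function independent
    -- of `m`.
    have hb := one_add_mul_self_le_rpow_one_add (s := w ^ 2 / m) (p := m * (1 / 2))
      (by linarith [show 0 ≤ w ^ 2 / (m : ℝ) by positivity]) (by linarith)
    have hb' : (1 + w ^ 2) / 2 ≤ (1 + w ^ 2 / (m : ℝ)) ^ ((m : ℝ) * (1 / 2)) := by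
      refine le_trans ?_ hb
      have : (m : ℝ) * (1 / 2) * (w ^ 2 / m) = w ^ 2 / 2 := by field_simp
      rw [this]
      linarith
    calc _ ≤ ((1 + w ^ 2) / 2)⁻¹ := by gcongr
      _ = _ := by rw [inv_div, div_eq_mul_inv]
  · filter_upwards with w
    have h1 := Real.tendsto_one_add_div_pow_exp (w ^ 2)
    have h2 := ((Real.continuous_sqrt.tendsto _).comp h1).inv₀
      (Real.sqrt_pos.2 (Real.exp_pos _)).ne'
    have h3 : (√(Real.exp (w ^ 2)))⁻¹ = Real.exp (-(1 / 2) * w ^ 2) := by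
      rw [← Real.exp_half, ← Real.exp_neg]
      congr 1
      ring
    rw [h3] at h2
    refine h2.congr' ?_
    filter_upwards with m
    rw [slopeDensity_div_sqrt]
    rfl

/-- This is an approximate antiderivative for the tail: the factor beside the density of index `k +
2` is at least `1`, decreases in `v`, and is near `1` when `k` and `k v²` are large. Integrating
over `(τ, ∞)` therefore bounds the tail on both sides. -/
theorem hasDerivAt_slopeDensity_div {k : ℕ} (hk : 0 < k) {v : ℝ} (hv : 0 < v) :
    HasDerivAt (fun v => slopeDensity k v / (k * v))
      (-(slopeDensity (k + 2) v * (1 + (1 + 1 / v ^ 2) / k))) v := by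
  have hs : 0 < 1 + v ^ 2 := by positivity
  have hG : 0 < √(1 + v ^ 2) := Real.sqrt_pos.2 hs
  have hsq : √(1 + v ^ 2) ^ 2 = 1 + v ^ 2 := Real.sq_sqrt hs.le
  have hk' : (k : ℝ) ≠ 0 := by positivity
  have h1 : HasDerivAt (fun v : ℝ => 1 + v ^ 2) (2 * v) v := by
    simpa using (hasDerivAt_pow 2 v).const_add 1
  have h2 := ((h1.sqrt hs.ne').inv hG.ne').pow k
  have h3 := h2.div ((hasDerivAt_id v).const_mul (k : ℝ)) (by positivity : (k : ℝ) * v ≠ 0)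
  refine h3.congr_deriv ?_
  obtain ⟨j, rfl⟩ : ∃ j, k = j + 1 := ⟨k - 1, by omega⟩
  simp only [slopeDensity, Nat.add_sub_cancel, id, Pi.inv_apply, Pi.pow_apply, inv_pow]
  set G := √(1 + v ^ 2)
  have hv2 : v ^ 2 = G ^ 2 - 1 := by linarith
  push_cast at hk' ⊢
  field_simp
  rw [hv2]
  ring

theorem tendsto_slopeDensity_div {k : ℕ} (hk : 0 < k) :
    Tendsto (fun v => slopeDensity k v / (k * v)) atTop (𝓝 0) := by
  have hk' : (0 : ℝ) < k := by positivity
  have h1 : Tendsto (fun v : ℝ => ((k : ℝ) * v)⁻¹) atTop (𝓝 0) :=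
    (tendsto_id.const_mul_atTop hk').inv_tendsto_atTop
  refine squeeze_zero' ?_ ?_ h1
  · filter_upwards [eventually_gt_atTop 0] with v hv
    exact div_nonneg (slopeDensity_pos k v).le (by positivity)
  · filter_upwards [eventually_gt_atTop 0] with v hv
    rw [div_eq_mul_inv]
    refine mul_le_of_le_one_left (by positivity) ?_
    unfold slopeDensity
    refine pow_le_one₀ (by positivity) (inv_le_one_of_one_le₀ ?_)
    rw [Real.one_le_sqrt]
    nlinarith [sq_nonneg v]

/-- Two-sided bounds of Mills-ratio type for the tail of the slope density. -/
theorem slopeDensity_tail_bounds {k : ℕ} (hk : 0 < k) {τ : ℝ} (hτ : 0 < τ) :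
    ∫ v in Set.Ioi τ, slopeDensity (k + 2) v ≤ slopeDensity k τ / (k * τ) ∧
      slopeDensity k τ / (k * τ) ≤
        (1 + (1 + 1 / τ ^ 2) / k) * ∫ v in Set.Ioi τ, slopeDensity (k + 2) v := by
  have hk' : (0 : ℝ) < k := by positivity
  have hderiv : ∀ v ∈ Set.Ici τ, HasDerivAt (fun v => slopeDensity k v / (k * v))
      (-(slopeDensity (k + 2) v * (1 + (1 + 1 / v ^ 2) / k))) v := fun v hv =>
    hasDerivAt_slopeDensity_div hk (hτ.trans_le hv)
  have hneg : ∀ v ∈ Set.Ioi τ, -(slopeDensity (k + 2) v * (1 + (1 + 1 / v ^ 2) / k)) ≤ 0 := by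
    intro v _
    have := slopeDensity_pos (k + 2) v
    have : 0 ≤ slopeDensity (k + 2) v * (1 + (1 + 1 / v ^ 2) / k) := by positivity
    linarith
  have hI := integral_Ioi_of_hasDerivAt_of_nonpos' hderiv hneg (tendsto_slopeDensity_div hk)
  have hint := (integrableOn_Ioi_deriv_of_nonpos' hderiv hneg (tendsto_slopeDensity_div hk)).neg
  rw [integral_neg, zero_sub, neg_inj] at hI
  simp only [Pi.neg_def, neg_neg] at hint
  have hint0 : IntegrableOn (slopeDensity (k + 2)) (Set.Ioi τ) :=
    (integrable_slopeDensity (by omega)).integrableOn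
  rw [← hI, ← integral_const_mul]
  constructor
  · refine setIntegral_mono_on hint0 hint measurableSet_Ioi fun v _ => ?_
    refine le_mul_of_one_le_right (slopeDensity_pos _ _).le ?_
    have : 0 ≤ (1 + 1 / v ^ 2) / (k : ℝ) := by positivity
    linarith
  · refine setIntegral_mono_on hint (hint0.const_mul _) measurableSet_Ioi fun v hv => ?_
    rw [mul_comm]
    have hv' : τ < v := hv
    have := slopeDensity_pos (k + 2) v
    gcongr

theorem slopeDensity_div_sqrt_one_sub (k : ℕ) {t : ℝ} (ht0 : 0 < t) (ht1 : t < 1) :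
    slopeDensity k (t / √(1 - t ^ 2)) / (k * (t / √(1 - t ^ 2))) =
      √(1 - t ^ 2) ^ (k + 1) / (k * t) := by
  have hu : 0 < 1 - t ^ 2 := by nlinarith
  have hs : 0 < √(1 - t ^ 2) := Real.sqrt_pos.2 hu
  have h1 : √(1 + (t / √(1 - t ^ 2)) ^ 2) = (√(1 - t ^ 2))⁻¹ := by
    rw [div_pow, Real.sq_sqrt hu.le, ← Real.sqrt_inv]
    congr 1
    field_simp
    ring
  unfold slopeDensity
  rw [h1, inv_inv]
  field_simp
  rw [pow_succ √(1 - t ^ 2) k]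

/-- Two-sided bounds for the probability of the cap `{y | t < ⟪x, y⟫}`. -/
theorem uniformSphere_cap_bounds {k : ℕ} (hk : 0 < k) (x : UnitSphere (k + 2)) {t : ℝ}
    (ht0 : 0 < t) (ht1 : t < 1) :
    (uniformSphere (k + 2)).real {y | t < inner ℝ (x : EuclideanSpace ℝ (Fin (k + 2))) y} ≤
        √(1 - t ^ 2) ^ (k + 1) / (k * t) / ∫ v, slopeDensity (k + 2) v ∧
      √(1 - t ^ 2) ^ (k + 1) / (k * t) / (∫ v, slopeDensity (k + 2) v) /
          (1 + 1 / (k * t ^ 2)) ≤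
        (uniformSphere (k + 2)).real {y | t < inner ℝ (x : EuclideanSpace ℝ (Fin (k + 2))) y} := by
  have hu : 0 < 1 - t ^ 2 := by nlinarith
  have hs : 0 < √(1 - t ^ 2) := Real.sqrt_pos.2 hu
  have hτ : 0 < t / √(1 - t ^ 2) := by positivity
  obtain ⟨h1, h2⟩ := slopeDensity_tail_bounds hk hτ
  rw [slopeDensity_div_sqrt_one_sub k ht0 ht1] at h1 h2
  have hc : 1 + (1 + 1 / (t / √(1 - t ^ 2)) ^ 2) / (k : ℝ) = 1 + 1 / (k * t ^ 2) := by
    rw [div_pow, Real.sq_sqrt hu.le]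
    field_simp
    ring
  rw [hc] at h2
  have hJ : 0 ≤ ∫ v, slopeDensity (k + 2) v :=
    integral_nonneg fun v => (slopeDensity_pos _ v).le
  rw [uniformSphere_real_cap (by omega) x ht0.le ht1]
  refine ⟨div_le_div_of_nonneg_right h1 hJ, ?_⟩
  rw [div_right_comm]
  refine div_le_div_of_nonneg_right ?_ hJ
  rw [div_le_iff₀' (by positivity)]
  exact h2

/-! ### Poisson approximation for dissociated events -/

/-- A polynomial-generating-function estimate: if `|φ' - c φ| ≤ ε` on `[0, 1]`, `φ 1 = 1` and
`c ≥ 0`, then `φ 0` is within `ε` of `exp (-c)`. -/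
theorem abs_sub_exp_neg_le {φ φ' : ℝ → ℝ} {c ε : ℝ} (hc : 0 ≤ c)
    (hφ : ∀ u, HasDerivAt φ (φ' u) u) (h1 : φ 1 = 1)
    (hε : ∀ u ∈ Set.Icc (0 : ℝ) 1, |φ' u - c * φ u| ≤ ε) :
    |φ 0 - Real.exp (-c)| ≤ ε := by
  -- The integrating factor `e^(-cu)` reduces the claim to the mean value inequality between `0` and
  -- `1`.
  have hd : ∀ u ∈ Set.Icc (0 : ℝ) 1, HasDerivWithinAt (fun u => Real.exp (-(c * u)) * φ u)
      (Real.exp (-(c * u)) * (φ' u - c * φ u)) (Set.Icc 0 1) u := by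
    intro u _
    have he : HasDerivAt (fun u => Real.exp (-(c * u))) (Real.exp (-(c * u)) * (-(c * 1))) u :=
      (((hasDerivAt_id u).const_mul c).neg).exp
    refine ((he.mul (hφ u)).congr_deriv ?_).hasDerivWithinAt
    ring
  have hb : ∀ u ∈ Set.Icc (0 : ℝ) 1, ‖Real.exp (-(c * u)) * (φ' u - c * φ u)‖ ≤ ε := by
    intro u hu
    rw [norm_mul, Real.norm_eq_abs, Real.norm_eq_abs, Real.abs_exp]
    have h2 : Real.exp (-(c * u)) ≤ 1 := Real.exp_le_one_iff.2 (by nlinarith [hu.1])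
    calc _ ≤ 1 * |φ' u - c * φ u| := by gcongr
      _ ≤ ε := by rw [one_mul]; exact hε u hu
  have := (convex_Icc (0 : ℝ) 1).norm_image_sub_le_of_norm_hasDerivWithin_le hd hb
    (Set.right_mem_Icc.2 zero_le_one) (Set.left_mem_Icc.2 zero_le_one)
  simpa [h1] using this

section
variable {Ω ι : Type*}

open Classical in
/-- The number of indices in `T` whose event occurs. -/
noncomputable def occurrences (A : ι → Set Ω) (T : Finset ι) (ω : Ω) : ℕ :=
  (T.filter fun a => ω ∈ A a).card

theorem occurrences_eq_sum (A : ι → Set Ω) (T : Finset ι) (ω : Ω) :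
    (occurrences A T ω : ℝ) = ∑ a ∈ T, (A a).indicator 1 ω := by
  classical
  simp [occurrences, Set.indicator_apply]

theorem measurable_occurrences [MeasurableSpace Ω] {A : ι → Set Ω} (hA : ∀ a, MeasurableSet (A a)) (T : Finset ι) :
    Measurable (occurrences A T) := by
  classical
  have : occurrences A T = fun ω => ∑ a ∈ T, (A a).indicator (fun _ => 1) ω := by
    ext ω
    simp [occurrences, Set.indicator_apply]
  rw [this]
  exact Finset.measurable_sum _ fun a _ => measurable_const.indicator (hA a)

theorem occurrences_add_compl [Fintype ι] [DecidableEq ι] (A : ι → Set Ω) (T : Finset ι) (ω : Ω) :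
    occurrences A T ω + occurrences A Tᶜ ω = occurrences A Finset.univ ω := by
  classical
  unfold occurrences
  rw [← Finset.card_union_of_disjoint
    (Finset.disjoint_filter_filter (disjoint_compl_right)), ← Finset.filter_union,
    Finset.union_compl]

/-- Poisson approximation for the probability that no event occurs, in a dissociated family. -/
theorem abs_measure_no_occurrence_sub_exp_le [MeasurableSpace Ω] [Fintype ι] [DecidableEq ι]
    (P : Measure Ω) [IsProbabilityMeasure P]
    {A : ι → Set Ω} (hA : ∀ a, MeasurableSet (A a)) (B : ι → Finset ι) (hB : ∀ a, a ∈ B a)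
    (hind : ∀ a, IndepFun ((A a).indicator (1 : Ω → ℝ)) (occurrences A (B a)ᶜ) P) :
    |P.real {ω | ∀ a, ω ∉ A a} - Real.exp (-∑ a, P.real (A a))| ≤
      (∑ a, ∑ b ∈ B a, P.real (A a) * P.real (A b)) +
        ∑ a, ∑ b ∈ (B a).erase a, P.real (A a ∩ A b) := by
  classical
  set W : Ω → ℕ := occurrences A Finset.univ with hW
  have hWm : Measurable W := measurable_occurrences hA _
  have hWle : ∀ ω, W ω ≤ Fintype.card ι := fun ω => Finset.card_le_univ _
  have hint : ∀ {g : Ω → ℝ}, Measurable g → (∃ C, ∀ ω, |g ω| ≤ C) → Integrable g P := by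
    rintro g hg ⟨C, hC⟩
    exact Integrable.of_bound hg.aestronglyMeasurable C (Filter.Eventually.of_forall hC)
  have hIint : ∀ {S : Set Ω}, MeasurableSet S → Integrable (S.indicator (1 : Ω → ℝ)) P :=
    fun hS => (integrable_const (1 : ℝ)).indicator hS
  have hI : ∀ a, Measurable ((A a).indicator (1 : Ω → ℝ)) := fun a =>
    measurable_one.indicator (hA a)
  have hIabs : ∀ a ω, |(A a).indicator (1 : Ω → ℝ) ω| ≤ 1 := by
    intro a ω
    by_cases h : ω ∈ A a <;> simp [h]
  have hpowm : ∀ {f : Ω → ℕ} (_ : Measurable f) (u : ℝ), Measurable fun ω => u ^ f ω :=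
    fun hf u => (measurable_from_nat (f := fun k => u ^ k)).comp hf
  have hpow_abs : ∀ {u : ℝ}, u ∈ Set.Icc (0 : ℝ) 1 → ∀ k : ℕ, |u ^ k| ≤ 1 := by
    intro u hu k
    rw [abs_of_nonneg (pow_nonneg hu.1 k)]
    exact pow_le_one₀ hu.1 hu.2
  have hpow_sub : ∀ {u : ℝ}, u ∈ Set.Icc (0 : ℝ) 1 → ∀ k l : ℕ, |u ^ k - u ^ l| ≤ 1 := by
    intro u hu k l
    have h1 := pow_nonneg hu.1 k
    have h2 := pow_le_one₀ (n := k) hu.1 hu.2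
    have h3 := pow_nonneg hu.1 l
    have h4 := pow_le_one₀ (n := l) hu.1 hu.2
    rw [abs_le]
    constructor <;> linarith
  have hsplit : ∀ a ω, W ω = occurrences A (B a) ω + occurrences A (B a)ᶜ ω := fun a ω =>
    (occurrences_add_compl A (B a) ω).symm
  -- the probability generating function is a polynomial
  have hgen : ∀ u : ℝ, ∫ ω, u ^ W ω ∂P =
      ∑ k ∈ Finset.range (Fintype.card ι + 1), P.real {ω | W ω = k} * u ^ k := by
    intro u
    have h1 : ∀ ω, u ^ W ω = ∑ k ∈ Finset.range (Fintype.card ι + 1),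
        {ω | W ω = k}.indicator (fun _ => u ^ k) ω := by
      intro ω
      rw [Finset.sum_eq_single (W ω)]
      · simp
      · intro k _ hk
        simp [hk.symm]
      · intro h
        exact absurd (Finset.mem_range.2 (Nat.lt_succ_of_le (hWle ω))) h
    have hms : ∀ k, MeasurableSet {ω | W ω = k} := fun k => hWm (measurableSet_singleton k)
    simp_rw [h1]
    rw [integral_finsetSum _ fun k _ => (integrable_const _).indicator (hms k)]
    refine Finset.sum_congr rfl fun k _ => ?_
    rw [integral_indicator_const _ (hms k), smul_eq_mul]
  have hgen' : ∀ u : ℝ, ∫ ω, (W ω : ℝ) * u ^ (W ω - 1) ∂P =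
      ∑ k ∈ Finset.range (Fintype.card ι + 1), P.real {ω | W ω = k} * (k * u ^ (k - 1)) := by
    intro u
    have h1 : ∀ ω, (W ω : ℝ) * u ^ (W ω - 1) = ∑ k ∈ Finset.range (Fintype.card ι + 1),
        {ω | W ω = k}.indicator (fun _ => (k : ℝ) * u ^ (k - 1)) ω := by
      intro ω
      rw [Finset.sum_eq_single (W ω)]
      · simp
      · intro k _ hk
        simp [hk.symm]
      · intro h
        exact absurd (Finset.mem_range.2 (Nat.lt_succ_of_le (hWle ω))) h
    have hms : ∀ k, MeasurableSet {ω | W ω = k} := fun k => hWm (measurableSet_singleton k)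
    simp_rw [h1]
    rw [integral_finsetSum _ fun k _ => (integrable_const _).indicator (hms k)]
    refine Finset.sum_congr rfl fun k _ => ?_
    rw [integral_indicator_const _ (hms k), smul_eq_mul]
  have hderiv : ∀ u : ℝ, HasDerivAt (fun u : ℝ => ∫ ω, u ^ W ω ∂P)
      (∫ ω, (W ω : ℝ) * u ^ (W ω - 1) ∂P) u := by
    intro u
    simp_rw [hgen]
    rw [hgen']
    exact HasDerivAt.fun_sum fun k _ => (hasDerivAt_pow k u).const_mul _
  have hzero : ∫ ω, (0 : ℝ) ^ W ω ∂P = P.real {ω | ∀ a, ω ∉ A a} := by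
    have hms : MeasurableSet {ω | W ω = 0} := hWm (measurableSet_singleton 0)
    have hs : {ω | ∀ a, ω ∉ A a} = {ω | W ω = 0} := by
      ext ω
      simp [hW, occurrences, Finset.filter_eq_empty_iff]
    rw [hs, ← integral_indicator_one hms]
    refine integral_congr_ae (Filter.Eventually.of_forall fun ω => ?_)
    by_cases h : W ω = 0 <;> simp [h]
  -- With `G(u) = E[u^W]`, this says that `G' ≈ (∑ P(A a)) G`. Write `V_a` for the number of
  -- occurrences outside `B a`. In each summand of `G'`, replace `u^(W-1)` by `u^(V_a)`, factor by
  -- independence, then replace `u^(V_a)` by `u^W`.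
  have hkey : ∀ u ∈ Set.Icc (0 : ℝ) 1,
      |(∫ ω, (W ω : ℝ) * u ^ (W ω - 1) ∂P) - (∑ a, P.real (A a)) * ∫ ω, u ^ W ω ∂P| ≤
      (∑ a, ∑ b ∈ B a, P.real (A a) * P.real (A b)) +
        ∑ a, ∑ b ∈ (B a).erase a, P.real (A a ∩ A b) := by
    intro u hu
    have hpi : ∀ {f : Ω → ℕ}, Measurable f → Integrable (fun ω => u ^ f ω) P := fun hf =>
      hint (hpowm hf u) ⟨1, fun ω => hpow_abs hu _⟩
    have hIpi : ∀ a {f : Ω → ℕ}, Measurable f →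
        Integrable (fun ω => (A a).indicator (1 : Ω → ℝ) ω * u ^ f ω) P := fun a f hf =>
      hint ((hI a).mul (hpowm hf u)) ⟨1, fun ω => by
        rw [abs_mul]
        exact mul_le_one₀ (hIabs a ω) (abs_nonneg _) (hpow_abs hu _)⟩
    have hVm : ∀ a, Measurable (occurrences A (B a)ᶜ) := fun a => measurable_occurrences hA _
    have hW1 : Measurable fun ω => W ω - 1 := (measurable_from_nat (f := fun k => k - 1)).comp hWm
    have hsum : (∫ ω, (W ω : ℝ) * u ^ (W ω - 1) ∂P) =
        ∑ a, ∫ ω, (A a).indicator (1 : Ω → ℝ) ω * u ^ (W ω - 1) ∂P := by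
      rw [← integral_finsetSum _ fun a _ => hIpi a hW1]
      refine integral_congr_ae (Filter.Eventually.of_forall fun ω => ?_)
      show (W ω : ℝ) * _ = _
      rw [hW, occurrences_eq_sum, Finset.sum_mul]
    have hindep : ∀ a, ∫ ω, (A a).indicator (1 : Ω → ℝ) ω * u ^ occurrences A (B a)ᶜ ω ∂P =
        P.real (A a) * ∫ ω, u ^ occurrences A (B a)ᶜ ω ∂P := by
      intro a
      have hm : Measurable fun k : ℕ => u ^ k := measurable_from_nat
      have h := (hind a).comp measurable_id hm
      have h2 := h.integral_mul_eq_mul_integral (hI a).aestronglyMeasurable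
        (hpowm (hVm a) u).aestronglyMeasurable
      rw [← integral_indicator_one (hA a)]
      exact h2
    -- On `A a` the exponents `W - 1` and `V_a` agree unless another event of `B a` occurs; then the
    -- difference of powers is at most `1`.
    have h2 : ∀ a, |(∫ ω, (A a).indicator (1 : Ω → ℝ) ω * u ^ (W ω - 1) ∂P) -
        ∫ ω, (A a).indicator (1 : Ω → ℝ) ω * u ^ occurrences A (B a)ᶜ ω ∂P| ≤
        ∑ b ∈ (B a).erase a, P.real (A a ∩ A b) := by
      intro a
      have hr : ∑ b ∈ (B a).erase a, P.real (A a ∩ A b) =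
          ∫ ω, ∑ b ∈ (B a).erase a, (A a ∩ A b).indicator (1 : Ω → ℝ) ω ∂P := by
        rw [integral_finsetSum _ fun b _ => hIint ((hA a).inter (hA b))]
        exact Finset.sum_congr rfl fun b _ => (integral_indicator_one ((hA a).inter (hA b))).symm
      rw [← integral_sub (hIpi a hW1) (hIpi a (hVm a)), hr, ← Real.norm_eq_abs]
      refine norm_integral_le_of_norm_le (integrable_finsetSum _ fun b _ =>
        hIint ((hA a).inter (hA b)))
        (Filter.Eventually.of_forall fun ω => ?_)
      rw [Real.norm_eq_abs]
      have hnn : ∀ b ∈ (B a).erase a, 0 ≤ (A a ∩ A b).indicator (1 : Ω → ℝ) ω := fun b _ =>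
        Set.indicator_nonneg (fun _ _ => zero_le_one) _
      by_cases ha : ω ∈ A a
      · simp only [Set.indicator_of_mem ha, Pi.one_apply, one_mul]
        by_cases hb : ∃ b ∈ (B a).erase a, ω ∈ A b
        · obtain ⟨b, hb, hωb⟩ := hb
          refine (hpow_sub hu _ _).trans (le_trans ?_ (Finset.single_le_sum hnn hb))
          simp [ha, hωb]
        · have hone : occurrences A (B a) ω = 1 := by
            unfold occurrences
            rw [Finset.card_eq_one]
            refine ⟨a, ?_⟩
            ext b
            simp only [Finset.mem_filter, Finset.mem_singleton]
            constructor
            · rintro ⟨h1, h2⟩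
              by_contra h3
              exact hb ⟨b, Finset.mem_erase.2 ⟨h3, h1⟩, h2⟩
            · rintro rfl
              exact ⟨hB b, ha⟩
          rw [hsplit a ω, hone, Nat.add_sub_cancel_left, sub_self, abs_zero]
          exact Finset.sum_nonneg hnn
      · simp only [Set.indicator_of_notMem ha, zero_mul, sub_self, abs_zero]
        exact Finset.sum_nonneg hnn
    -- Here `V_a = W` unless some event of `B a`, possibly `A a` itself, occurs.
    have h3 : ∀ a, |(∫ ω, u ^ occurrences A (B a)ᶜ ω ∂P) - ∫ ω, u ^ W ω ∂P| ≤
        ∑ b ∈ B a, P.real (A b) := by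
      intro a
      have hr : ∑ b ∈ B a, P.real (A b) =
          ∫ ω, ∑ b ∈ B a, (A b).indicator (1 : Ω → ℝ) ω ∂P := by
        rw [integral_finsetSum _ fun b _ => hIint (hA b)]
        exact Finset.sum_congr rfl fun b _ => (integral_indicator_one (hA b)).symm
      rw [← integral_sub (hpi (hVm a)) (hpi hWm), hr, ← Real.norm_eq_abs]
      refine norm_integral_le_of_norm_le (integrable_finsetSum _ fun b _ =>
        hIint (hA b)) (Filter.Eventually.of_forall fun ω => ?_)
      rw [Real.norm_eq_abs, ← occurrences_eq_sum]
      rcases Nat.eq_zero_or_pos (occurrences A (B a) ω) with h | h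
      · rw [hsplit a ω, h, zero_add, sub_self, abs_zero, Nat.cast_zero]
      · exact (hpow_sub hu _ _).trans (by exact_mod_cast h)
    rw [hsum, Finset.sum_mul, ← Finset.sum_sub_distrib, add_comm, ← Finset.sum_add_distrib]
    refine (Finset.abs_sum_le_sum_abs _ _).trans (Finset.sum_le_sum fun a _ => ?_)
    refine (abs_sub_le _ (∫ ω, (A a).indicator (1 : Ω → ℝ) ω * u ^ occurrences A (B a)ᶜ ω ∂P)
      _).trans (add_le_add (h2 a) ?_)
    rw [hindep, ← mul_sub, abs_mul, abs_of_nonneg measureReal_nonneg, ← Finset.mul_sum]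
    exact mul_le_mul_of_nonneg_left (h3 a) measureReal_nonneg
  have := abs_sub_exp_neg_le (Finset.sum_nonneg fun a _ => measureReal_nonneg) hderiv
    (by simp) hkey
  rwa [hzero] at this

end

/-! ### Related pairs among independent points -/

/-- Under a product measure, functions of disjoint sets of coordinates are independent. -/
theorem indepFun_pi_of_dependsOn {ι E β γ : Type*} [Fintype ι] [DecidableEq ι] [MeasurableSpace E]
    [MeasurableSpace β] [MeasurableSpace γ] (μ : Measure E) [IsProbabilityMeasure μ]
    {S T : Finset ι} (hST : Disjoint S T) {f : (ι → E) → β} {g : (ι → E) → γ}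
    (hf : Measurable f) (hg : Measurable g)
    (hfS : ∀ x x' : ι → E, (∀ i ∈ S, x i = x' i) → f x = f x')
    (hgT : ∀ x x' : ι → E, (∀ i ∈ T, x i = x' i) → g x = g x') :
    IndepFun f g (Measure.pi fun _ => μ) := by
  have hne : Nonempty E := nonempty_of_isProbabilityMeasure μ
  let e₀ : E := Classical.arbitrary E
  -- Filling the coordinates outside `U` with an arbitrary `e₀` lets `f` and `g` factor through the
  -- restrictions to `S` and `T`.
  let ext : (U : Finset ι) → (U → E) → ι → E := fun U y i => if h : i ∈ U then y ⟨i, h⟩ else e₀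
  have hext : ∀ U, Measurable (ext U) := by
    intro U
    refine measurable_pi_lambda _ fun i => ?_
    by_cases h : i ∈ U
    · simpa [ext, h] using measurable_pi_apply (⟨i, h⟩ : U)
    · simp [ext, h]
  have hind : iIndepFun (fun (i : ι) (x : ι → E) => x i) (Measure.pi fun _ => μ) :=
    iIndepFun_pi (X := fun _ => id) fun _ => aemeasurable_id
  have h := (hind.indepFun_finset S T hST measurable_pi_apply).comp
    (hf.comp (hext S)) (hg.comp (hext T))
  have h1 : (f ∘ ext S) ∘ (fun (x : ι → E) (i : S) => x i) = f := by
    funext x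
    exact hfS _ _ fun i hi => by simp [ext, hi]
  have h2 : (g ∘ ext T) ∘ (fun (x : ι → E) (i : T) => x i) = g := by
    funext x
    exact hgT _ _ fun i hi => by simp [ext, hi]
  rwa [h1, h2] at h

theorem card_pairs_mul_two (n : ℕ) :
    Fintype.card {q : Fin n × Fin n // q.1 < q.2} * 2 = n * (n - 1) := by
  rw [Fintype.card_subtype, Finset.card_filter, ← Finset.univ_product_univ,
    Finset.sum_product_right]
  simp_rw [← Finset.card_filter]
  have : ∀ j : Fin n, (Finset.univ.filter fun i : Fin n => i < j).card = j := by
    intro j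
    rw [Finset.filter_gt_eq_Iio, Fin.card_Iio]
  simp_rw [this]
  rw [Fin.sum_univ_eq_sum_range (fun i => i), Finset.sum_range_id_mul_two]

section
variable {E : Type*} [MeasurableSpace E] {μ : Measure E} [IsProbabilityMeasure μ]
  {R : E → E → Prop} {r : ℝ}

theorem pi_real_rel {ι : Type*} [Fintype ι] (hR : MeasurableSet {q : E × E | R q.1 q.2})
    (hr : ∀ x, μ.real {y | R x y} = r) {i j : ι} (hij : i ≠ j) :
    (Measure.pi fun _ : ι => μ).real {x | R (x i) (x j)} = r := by
  have hind : iIndepFun (fun (i : ι) (x : ι → E) => x i) (Measure.pi fun _ => μ) :=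
    iIndepFun_pi (X := fun _ => id) fun _ => aemeasurable_id
  have hlaw : (Measure.pi fun _ : ι => μ).map (fun x => (x i, x j)) = μ.prod μ := by
    rw [(indepFun_iff_map_prod_eq_prod_map_map (measurable_pi_apply i).aemeasurable
      (measurable_pi_apply j).aemeasurable).1 (hind.indepFun hij)]
    simp [(measurePreserving_eval (fun _ : ι => μ) _).map_eq]
  have hm : Measurable fun x : ι → E => (x i, x j) := by fun_prop
  have hr' : ∀ x, μ (Prod.mk x ⁻¹' {q : E × E | R q.1 q.2}) = ENNReal.ofReal r := fun x => by
    rw [← hr x, ofReal_measureReal]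
    rfl
  have h0 : 0 ≤ r := by
    obtain ⟨x⟩ := nonempty_of_isProbabilityMeasure μ
    rw [← hr x]; exact measureReal_nonneg
  have : (Measure.pi fun _ : ι => μ) {x | R (x i) (x j)} = ENNReal.ofReal r := by
    rw [show {x : ι → E | R (x i) (x j)} = (fun x => (x i, x j)) ⁻¹' {q : E × E | R q.1 q.2} from
      rfl, ← Measure.map_apply hm hR, hlaw, Measure.prod_apply hR]
    rw [lintegral_congr hr', lintegral_const, measure_univ, mul_one]
  rw [measureReal_def, this, ENNReal.toReal_ofReal h0]

/-- Given the common point `x c`, the two relations are independent with probability `r` each,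
whatever `x c` is. Thus overlapping pairs cost only `r²` in the Poisson bound. -/
theorem pi_real_rel_inter {ι : Type*} [Fintype ι] (hR : MeasurableSet {q : E × E | R q.1 q.2})
    (hr : ∀ x, μ.real {y | R x y} = r) {c k l : ι} (hck : c ≠ k) (hcl : c ≠ l) (hkl : k ≠ l) :
    (Measure.pi fun _ : ι => μ).real {x | R (x c) (x k) ∧ R (x c) (x l)} = r * r := by
  have hind : iIndepFun (fun (i : ι) (x : ι → E) => x i) (Measure.pi fun _ => μ) :=
    iIndepFun_pi (X := fun _ => id) fun _ => aemeasurable_id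
  have hm2 : Measurable fun x : ι → E => (x k, x l) := by fun_prop
  have hm : Measurable fun x : ι → E => (x c, (x k, x l)) := by fun_prop
  have hev : ∀ i, (Measure.pi fun _ : ι => μ).map (fun x => x i) = μ := fun i =>
    (measurePreserving_eval (fun _ : ι => μ) i).map_eq
  have hlaw2 : (Measure.pi fun _ : ι => μ).map (fun x => (x k, x l)) = μ.prod μ := by
    rw [(indepFun_iff_map_prod_eq_prod_map_map (measurable_pi_apply k).aemeasurable
      (measurable_pi_apply l).aemeasurable).1 (hind.indepFun hkl), hev, hev]
  have hlaw : (Measure.pi fun _ : ι => μ).map (fun x => (x c, (x k, x l))) =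
      μ.prod (μ.prod μ) := by
    rw [(indepFun_iff_map_prod_eq_prod_map_map (measurable_pi_apply c).aemeasurable
      hm2.aemeasurable).1 (hind.indepFun_prodMk measurable_pi_apply k l c hck.symm hcl.symm).symm,
      hlaw2, hev]
  have hR2 : MeasurableSet {q : E × (E × E) | R q.1 q.2.1 ∧ R q.1 q.2.2} := by
    have h1 : Measurable fun q : E × (E × E) => (q.1, q.2.1) := by fun_prop
    have h2 : Measurable fun q : E × (E × E) => (q.1, q.2.2) := by fun_prop
    exact (h1 hR).inter (h2 hR)
  have hr' : ∀ x, μ {y | R x y} = ENNReal.ofReal r := fun x => by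
    rw [← hr x, ofReal_measureReal]
  have h0 : 0 ≤ r := by
    obtain ⟨x⟩ := nonempty_of_isProbabilityMeasure μ
    rw [← hr x]; exact measureReal_nonneg
  have hsl : ∀ x, (μ.prod μ) (Prod.mk x ⁻¹' {q : E × (E × E) | R q.1 q.2.1 ∧ R q.1 q.2.2}) =
      ENNReal.ofReal (r * r) := by
    intro x
    rw [ENNReal.ofReal_mul h0, ← hr' x, ← Measure.prod_prod]
    rfl
  have : (Measure.pi fun _ : ι => μ) {x | R (x c) (x k) ∧ R (x c) (x l)} =
      ENNReal.ofReal (r * r) := by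
    rw [show {x : ι → E | R (x c) (x k) ∧ R (x c) (x l)} = (fun x => (x c, (x k, x l))) ⁻¹'
      {q : E × (E × E) | R q.1 q.2.1 ∧ R q.1 q.2.2} from rfl, ← Measure.map_apply hm hR2, hlaw,
      Measure.prod_apply hR2]
    rw [lintegral_congr hsl, lintegral_const, measure_univ, mul_one]
  rw [measureReal_def, this, ENNReal.toReal_ofReal (mul_nonneg h0 h0)]

/-- Poisson approximation for the number of related pairs among `n` independent points, when each
point is related to a given one with the same probability `r`. -/
theorem abs_measure_no_related_pair_sub_exp_le (n : ℕ)
    (hR : MeasurableSet {q : E × E | R q.1 q.2}) (hsymm : ∀ x y, R x y → R y x)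
    (hr : ∀ x, μ.real {y | R x y} = r) :
    |(Measure.pi fun _ : Fin n => μ).real {x | ∀ i j, i < j → ¬ R (x i) (x j)} -
      Real.exp (-((n : ℝ) * (n - 1) / 2 * r))| ≤ 8 * (n : ℝ) ^ 3 * r ^ 2 := by
  classical
  have hsymm' : ∀ x y, R x y ↔ R y x := fun x y => ⟨hsymm x y, hsymm y x⟩
  let ι := {q : Fin n × Fin n // q.1 < q.2}
  let A : ι → Set (Fin n → E) := fun a => {x | R (x a.1.1) (x a.1.2)}
  let s : ι → Finset (Fin n) := fun a => {a.1.1, a.1.2}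
  -- The dependency neighbourhood consists of the pairs meeting `a`; pairs outside it involve
  -- disjoint coordinates.
  let B : ι → Finset ι := fun a => Finset.univ.filter fun b => b.1.1 ∈ s a ∨ b.1.2 ∈ s a
  have hA : ∀ a, MeasurableSet (A a) := fun a => by
    have : Measurable fun x : Fin n → E => (x a.1.1, x a.1.2) := by fun_prop
    exact this hR
  have hB : ∀ a, a ∈ B a := fun a => by simp [B, s]
  have hind : ∀ a, IndepFun ((A a).indicator (1 : (Fin n → E) → ℝ)) (occurrences A (B a)ᶜ)
      (Measure.pi fun _ : Fin n => μ) := by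
    intro a
    refine indepFun_pi_of_dependsOn μ (S := s a) (T := (s a)ᶜ) disjoint_compl_right
      (measurable_one.indicator (hA a)) (measurable_occurrences hA _) ?_ ?_
    · intro x x' h
      have h1 := h a.1.1 (by simp [s])
      have h2 := h a.1.2 (by simp [s])
      have : x ∈ A a ↔ x' ∈ A a := by
        show R _ _ ↔ R _ _
        rw [h1, h2]
      by_cases hx : x ∈ A a
      · rw [Set.indicator_of_mem hx, Set.indicator_of_mem (this.1 hx)]
        rfl
      · rw [Set.indicator_of_notMem hx, Set.indicator_of_notMem (fun h => hx (this.2 h))]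
    · intro x x' h
      unfold occurrences
      congr 1
      refine Finset.filter_congr fun b hb => ?_
      have hb' : b.1.1 ∉ s a ∧ b.1.2 ∉ s a := by simpa [B] using hb
      show R _ _ ↔ R _ _
      rw [h _ (Finset.mem_compl.2 hb'.1), h _ (Finset.mem_compl.2 hb'.2)]
  have hone : ∀ a, (Measure.pi fun _ : Fin n => μ).real (A a) = r := fun a =>
    pi_real_rel hR hr a.2.ne
  have htwo : ∀ a, ∀ b ∈ (B a).erase a,
      (Measure.pi fun _ : Fin n => μ).real (A a ∩ A b) = r * r := by
    rintro ⟨⟨i, j⟩, hij : i < j⟩ ⟨⟨k, l⟩, hkl : k < l⟩ hb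
    have hb' : ¬(k = i ∧ l = j) ∧ ((k = i ∨ k = j) ∨ (l = i ∨ l = j)) := by
      simpa [B, s, ι] using hb
    show (Measure.pi fun _ : Fin n => μ).real {x | R (x i) (x j) ∧ R (x k) (x l)} = r * r
    -- Distinct pairs meeting each other share exactly one point; symmetry of `R` brings each of the
    -- four positions to the form with a common centre.
    obtain ⟨hne, (rfl | rfl) | (rfl | rfl)⟩ := hb'
    · exact pi_real_rel_inter hR hr hij.ne hkl.ne fun h => hne ⟨rfl, h.symm⟩
    · have := pi_real_rel_inter (μ := μ) hR hr hij.ne' hkl.ne (hij.trans hkl).ne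
      rw [← this]
      congr 1
      ext x
      exact and_congr_left' (hsymm' _ _)
    · have := pi_real_rel_inter (μ := μ) hR hr hij.ne hkl.ne' (hkl.trans hij).ne'
      rw [← this]
      congr 1
      ext x
      exact and_congr_right' (hsymm' _ _)
    · have := pi_real_rel_inter (μ := μ) hR hr hij.ne' hkl.ne' fun h => hne ⟨h.symm, rfl⟩
      rw [← this]
      congr 1
      ext x
      exact and_congr (hsymm' _ _) (hsymm' _ _)
  have hcard : (Fintype.card ι : ℝ) = n * (n - 1) / 2 := by
    have h := card_pairs_mul_two n
    rcases Nat.eq_zero_or_pos n with h0 | h0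
    · subst h0
      simp [ι]
    · have h' : (Fintype.card ι : ℝ) * 2 = n * (n - 1) := by
        rw [← Nat.cast_pred h0]
        exact_mod_cast h
      linarith
  have hBcard : ∀ a, ((B a).card : ℝ) ≤ 4 * n := by
    intro a
    have h1 : (B a).card ≤ (s a ×ˢ Finset.univ ∪ Finset.univ ×ˢ s a).card := by
      refine Finset.card_le_card_of_injOn Subtype.val ?_ Subtype.val_injective.injOn
      intro b hb
      simpa [B] using hb
    have h2 : (s a).card ≤ 2 := Finset.card_le_two
    have h3 := h1.trans (Finset.card_union_le _ _)
    rw [Finset.card_product, Finset.card_product, Finset.card_univ, Fintype.card_fin] at h3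
    have h4 : (B a).card ≤ 4 * n := by nlinarith
    exact_mod_cast h4
  have key := abs_measure_no_occurrence_sub_exp_le (Measure.pi fun _ : Fin n => μ) hA B hB hind
  have hev : {x : Fin n → E | ∀ a, x ∉ A a} = {x | ∀ i j, i < j → ¬ R (x i) (x j)} := by
    ext x
    exact ⟨fun h i j hij => h ⟨(i, j), hij⟩, fun h a => h _ _ a.2⟩
  rw [hev] at key
  simp_rw [hone] at key
  rw [Finset.sum_const, Finset.card_univ, nsmul_eq_mul, hcard] at key
  refine key.trans ?_
  have hterm : ∀ a, ∑ b ∈ B a, r * r ≤ 4 * n * r ^ 2 := fun a => by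
    rw [Finset.sum_const, nsmul_eq_mul, ← sq]
    exact mul_le_mul_of_nonneg_right (hBcard a) (sq_nonneg r)
  have hterm2 : ∀ a, ∑ b ∈ (B a).erase a,
      (Measure.pi fun _ : Fin n => μ).real (A a ∩ A b) ≤ 4 * n * r ^ 2 := fun a => by
    rw [Finset.sum_congr rfl (htwo a)]
    exact (Finset.sum_le_sum_of_subset_of_nonneg (Finset.erase_subset _ _)
      fun _ _ _ => mul_self_nonneg r).trans (hterm a)
  have hn : (Fintype.card ι : ℝ) ≤ n ^ 2 := by rw [hcard]; nlinarith [Nat.cast_nonneg (α := ℝ) n]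
  have hnn : 0 ≤ 4 * (n : ℝ) * r ^ 2 := by positivity
  calc _ ≤ ∑ a : ι, 4 * n * r ^ 2 + ∑ a : ι, 4 * n * r ^ 2 :=
        add_le_add (Finset.sum_le_sum fun a _ => hterm a) (Finset.sum_le_sum fun a _ => hterm2 a)
    _ = Fintype.card ι * (4 * n * r ^ 2) * 2 := by
        rw [Finset.sum_const, Finset.card_univ, nsmul_eq_mul]; ring
    _ ≤ n ^ 2 * (4 * n * r ^ 2) * 2 := by gcongr
    _ = _ := by ring

end

/-- Poisson limit for the absence of related pairs. -/
theorem tendsto_measure_no_related_pair {E : ℕ → Type*} [∀ n, MeasurableSpace (E n)]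
    (μ : ∀ n, Measure (E n)) [∀ n, IsProbabilityMeasure (μ n)] (R : ∀ n, E n → E n → Prop)
    (hR : ∀ n, MeasurableSet {q : E n × E n | R n q.1 q.2})
    (hsymm : ∀ n x y, R n x y → R n y x) {r : ℕ → ℝ}
    (hr : ∀ᶠ n in atTop, ∀ x, (μ n).real {y | R n x y} = r n) {c : ℝ}
    (hc : Tendsto (fun n : ℕ => (n : ℝ) ^ 2 / 2 * r n) atTop (𝓝 c)) :
    Tendsto (fun n => (Measure.pi fun _ : Fin n => μ n).real
      {x | ∀ i j, i < j → ¬ R n (x i) (x j)}) atTop (𝓝 (Real.exp (-c))) := by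
  have hinv : Tendsto (fun n : ℕ => (n : ℝ)⁻¹) atTop (𝓝 0) := tendsto_inv_atTop_nhds_zero_nat
  have h1 : Tendsto (fun n : ℕ => (n : ℝ) * (n - 1) / 2 * r n) atTop (𝓝 c) := by
    have := hc.mul ((tendsto_const_nhds (x := (1 : ℝ))).sub hinv)
    rw [sub_zero, mul_one] at this
    refine this.congr' ?_
    filter_upwards [eventually_gt_atTop 0] with n hn
    have : (n : ℝ) ≠ 0 := by positivity
    field_simp
  have h2 : Tendsto (fun n : ℕ => 8 * (n : ℝ) ^ 3 * r n ^ 2) atTop (𝓝 0) := by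
    -- `8 n³ r² = 32 (n² r / 2)² / n`.
    have := ((hc.mul hc).mul hinv).const_mul 32
    rw [mul_zero, mul_zero] at this
    refine this.congr' ?_
    filter_upwards [eventually_gt_atTop 0] with n hn
    have : (n : ℝ) ≠ 0 := by positivity
    field_simp
    ring
  have h3 := (Real.continuous_exp.tendsto _).comp h1.neg
  refine (tendsto_iff_of_dist (squeeze_zero' (Eventually.of_forall fun _ => dist_nonneg) ?_ h2)).2 h3
  filter_upwards [hr] with n hn
  rw [Real.dist_eq]
  exact abs_measure_no_related_pair_sub_exp_le n (hR n) (hsymm n) hn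

/-! ### Asymptotics of the threshold and of the cap probability -/

/-- The centred and scaled squared threshold `4 log n - log log n + y`. -/
noncomputable def coherenceLevel (y : ℝ) (n : ℕ) : ℝ :=
  4 * Real.log n - Real.log (Real.log n) + y

theorem tendsto_log_natCast_atTop : Tendsto (fun n : ℕ => Real.log n) atTop atTop :=
  Real.tendsto_log_atTop.comp tendsto_natCast_atTop_atTop

theorem tendsto_coherenceLevel_div_log (y : ℝ) :
    Tendsto (fun n : ℕ => coherenceLevel y n / Real.log n) atTop (𝓝 4) := by
  have h1 : Tendsto (fun x : ℝ => Real.log x / x) atTop (𝓝 0) :=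
    Real.isLittleO_log_id_atTop.tendsto_div_nhds_zero
  have h2 := h1.comp tendsto_log_natCast_atTop
  have h3 : Tendsto (fun n : ℕ => y / Real.log n) atTop (𝓝 0) :=
    tendsto_log_natCast_atTop.const_div_atTop y
  have h4 := ((tendsto_const_nhds (x := (4 : ℝ))).sub h2).add h3
  rw [sub_zero, add_zero] at h4
  refine h4.congr' ?_
  filter_upwards [tendsto_log_natCast_atTop.eventually_gt_atTop 0] with n hn
  simp only [Function.comp, coherenceLevel]
  field_simp

theorem tendsto_coherenceLevel (y : ℝ) : Tendsto (coherenceLevel y) atTop atTop := by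
  have := (tendsto_coherenceLevel_div_log y).pos_mul_atTop (by norm_num) tendsto_log_natCast_atTop
  refine this.congr' ?_
  filter_upwards [tendsto_log_natCast_atTop.eventually_gt_atTop 0] with n hn
  field_simp

theorem abs_log_one_sub_add_le {x : ℝ} (h0 : 0 ≤ x) (h1 : x < 1) :
    |x + x ^ 2 / 2 + Real.log (1 - x)| ≤ x ^ 3 / (1 - x) := by
  have h := Real.abs_log_sub_add_sum_range_le (x := x) (by rwa [abs_of_nonneg h0]) 2
  rw [abs_of_nonneg h0] at h
  simpa [Finset.sum_range_succ, one_add_one_eq_two] using h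

theorem integral_slopeDensity_pos {m : ℕ} (hm : 2 ≤ m) : 0 < ∫ v, slopeDensity m v := by
  rw [integral_pos_iff_support_of_nonneg (fun v => (slopeDensity_pos m v).le)
    (integrable_slopeDensity hm)]
  have : Function.support (slopeDensity m) = Set.univ :=
    Set.eq_univ_of_forall fun v => (slopeDensity_pos m v).ne'
  simp [this]

section
variable {p : ℕ → ℕ} {α : ℝ}

/-- A finite limit eventually gives `√p ≥ log n / (|α| + 1)`, which forces the dimension to
infinity. -/
theorem tendsto_natCast_dimension (hp : ∀ n, 1 ≤ p n)
    (hlim : Tendsto (fun n : ℕ => Real.log (n : ℝ) / √(p n)) atTop (𝓝 α)) :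
    Tendsto (fun n => (p n : ℝ)) atTop atTop := by
  have hb : ∀ᶠ n : ℕ in atTop, Real.log (n : ℝ) / √(p n) < |α| + 1 :=
    hlim.eventually_lt_const (lt_of_le_of_lt (le_abs_self α) (lt_add_one _))
  have h1 : Tendsto (fun n => √(p n : ℝ)) atTop atTop := by
    refine tendsto_atTop_mono' _ ?_
      (tendsto_log_natCast_atTop.atTop_div_const (show 0 < |α| + 1 by positivity))
    filter_upwards [hb] with n hn
    have : 0 < √(p n : ℝ) := Real.sqrt_pos.2 (by exact_mod_cast hp n)
    rw [div_lt_iff₀ this] at hn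
    rw [div_le_iff₀ (by positivity)]
    linarith
  refine (h1.atTop_mul_atTop₀ h1).congr fun n => ?_
  exact Real.mul_self_sqrt (Nat.cast_nonneg _)

theorem tendsto_coherenceLevel_sq_div (hp : ∀ n, 1 ≤ p n)
    (hlim : Tendsto (fun n : ℕ => Real.log (n : ℝ) / √(p n)) atTop (𝓝 α)) (y : ℝ) :
    Tendsto (fun n : ℕ => coherenceLevel y n ^ 2 / p n) atTop (𝓝 (16 * α ^ 2)) := by
  have h := ((tendsto_coherenceLevel_div_log y).mul hlim).pow 2
  rw [show (4 * α) ^ 2 = 16 * α ^ 2 by ring] at h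
  refine h.congr' ?_
  filter_upwards [tendsto_log_natCast_atTop.eventually_gt_atTop 0] with n hn
  have hpn : (0 : ℝ) < p n := by exact_mod_cast hp n
  rw [div_mul_div_cancel₀ hn.ne', div_pow, Real.sq_sqrt hpn.le]

theorem tendsto_coherenceLevel_div_dimension (hp : ∀ n, 1 ≤ p n)
    (hlim : Tendsto (fun n : ℕ => Real.log (n : ℝ) / √(p n)) atTop (𝓝 α)) (y : ℝ) :
    Tendsto (fun n : ℕ => coherenceLevel y n / p n) atTop (𝓝 0) := by
  have h := (tendsto_coherenceLevel_sq_div hp hlim y).mul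
    (tendsto_coherenceLevel y).inv_tendsto_atTop
  rw [mul_zero] at h
  refine h.congr' ?_
  filter_upwards [(tendsto_coherenceLevel y).eventually_gt_atTop 0] with n hn
  simp only [Pi.inv_apply]
  field_simp

/-- With `x = a / p`, the linear term of the logarithm cancels `a / 2` up to `x / 2 → 0`. The
quadratic term leaves `-a² / (4p) → -4α²`, and the cubic remainder is of order `(a² / p) x → 0`. -/
theorem tendsto_half_level_add_log (hp : ∀ n, 1 ≤ p n)
    (hlim : Tendsto (fun n : ℕ => Real.log (n : ℝ) / √(p n)) atTop (𝓝 α)) (y : ℝ) :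
    Tendsto (fun n : ℕ => coherenceLevel y n / 2 +
      ((p n : ℝ) - 1) / 2 * Real.log (1 - coherenceLevel y n / p n)) atTop
      (𝓝 (-(4 * α ^ 2))) := by
  set a := coherenceLevel y with ha
  have hx := tendsto_coherenceLevel_div_dimension hp hlim y
  have hsq := tendsto_coherenceLevel_sq_div hp hlim y
  have hP := tendsto_natCast_dimension hp hlim
  rw [← ha] at hx hsq
  have hPinv : Tendsto (fun n => ((p n : ℝ))⁻¹) atTop (𝓝 0) := hP.inv_tendsto_atTop
  -- the main part
  have hmain : Tendsto (fun n : ℕ => a n / p n / 2 - a n ^ 2 / p n * (1 - (p n : ℝ)⁻¹) / 4) atTop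
      (𝓝 (-(4 * α ^ 2))) := by
    have h := (hx.div_const 2).sub
      ((hsq.mul ((tendsto_const_nhds (x := (1 : ℝ))).sub hPinv)).div_const 4)
    convert h using 2
    ring
  have hone : Tendsto (fun n => 1 - a n / p n) atTop (𝓝 1) := by
    simpa using (tendsto_const_nhds (x := (1 : ℝ))).sub hx
  have herr : Tendsto (fun n : ℕ => a n ^ 2 / p n * (a n / p n) / (1 - a n / p n)) atTop
      (𝓝 0) := by
    have h := (hsq.mul hx).div hone one_ne_zero
    rw [mul_zero, zero_div] at h
    exact h
  refine (tendsto_iff_of_dist (squeeze_zero' (Eventually.of_forall fun _ => dist_nonneg) ?_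
    herr)).1 hmain
  filter_upwards [(tendsto_coherenceLevel y).eventually_gt_atTop 0,
    hx.eventually_lt_const one_pos] with n hn0 hn1
  have hpn : (1 : ℝ) ≤ p n := by exact_mod_cast hp n
  have hp0 : (0 : ℝ) < p n := by linarith
  have hx0 : 0 ≤ a n / p n := by positivity
  have hb := abs_log_one_sub_add_le hx0 hn1
  rw [Real.dist_eq, abs_sub_comm]
  set x := a n / p n with hxdef
  have hax : a n = x * p n := by rw [hxdef]; field_simp
  have hid : a n / 2 + ((p n : ℝ) - 1) / 2 * Real.log (1 - x) -
      (x / 2 - a n ^ 2 / p n * (1 - (p n : ℝ)⁻¹) / 4) =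
      ((p n : ℝ) - 1) / 2 * (x + x ^ 2 / 2 + Real.log (1 - x)) := by
    rw [hax]
    field_simp
    ring
  rw [hid, abs_mul, abs_of_nonneg (by linarith)]
  have h1x : 0 < 1 - x := by linarith
  calc _ ≤ (p n : ℝ) * (x ^ 3 / (1 - x)) := by
        gcongr
        linarith
    _ = _ := by
        rw [hax]
        field_simp

/-- Writing `L = log n`, one has `n² e^(-a/2) = √L e^(-y/2)`. This is the purpose of the `log log n`
correction: it matches the `√a` from the tail bound, and `√(L / a) → 1/2`. -/
theorem tendsto_sq_mul_sqrt_one_sub_pow (hp : ∀ n, 1 ≤ p n)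
    (hlim : Tendsto (fun n : ℕ => Real.log (n : ℝ) / √(p n)) atTop (𝓝 α)) (y : ℝ) :
    Tendsto (fun n : ℕ => (n : ℝ) ^ 2 * √(1 - coherenceLevel y n / p n) ^ (p n - 1) /
      √(coherenceLevel y n)) atTop (𝓝 (Real.exp (-(y + 8 * α ^ 2) / 2) / 2)) := by
  have h1 := (tendsto_half_level_add_log hp hlim y).const_add (-y / 2)
  have h2 := (Real.continuous_exp.tendsto _).comp h1
  have h3 : Tendsto (fun n : ℕ => (√(coherenceLevel y n / Real.log n))⁻¹) atTop (𝓝 (2 : ℝ)⁻¹) := by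
    have h := ((Real.continuous_sqrt.tendsto _).comp (tendsto_coherenceLevel_div_log y)).inv₀
      (by norm_num)
    rwa [show √4 = (2 : ℝ) by rw [show (4 : ℝ) = 2 ^ 2 by norm_num]; exact Real.sqrt_sq (by norm_num)]
      at h
  have h4 := h2.mul h3
  rw [show Real.exp (-y / 2 + -(4 * α ^ 2)) * 2⁻¹ = Real.exp (-(y + 8 * α ^ 2) / 2) / 2 by
    rw [div_eq_mul_inv]; congr 2; ring] at h4
  refine h4.congr' ?_
  filter_upwards [(tendsto_coherenceLevel y).eventually_gt_atTop 0,
    (tendsto_coherenceLevel_div_dimension hp hlim y).eventually_lt_const one_pos,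
    tendsto_log_natCast_atTop.eventually_gt_atTop 0, eventually_gt_atTop 0] with n ha hx hL hn
  have hn' : (0 : ℝ) < n := by exact_mod_cast hn
  set L := Real.log n with hLdef
  set x := coherenceLevel y n / p n with hxdef
  have h1x : 0 < 1 - x := by linarith
  have e1 : (n : ℝ) ^ 2 = Real.exp (2 * L) := by
    rw [two_mul, Real.exp_add, hLdef, Real.exp_log hn', sq]
  have e2 : √(1 - x) ^ (p n - 1) = Real.exp (((p n : ℝ) - 1) / 2 * Real.log (1 - x)) := by
    rw [← Nat.cast_pred (hp n), ← Real.exp_log (Real.sqrt_pos.2 h1x), ← Real.exp_nat_mul,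
      Real.log_sqrt h1x.le]
    congr 1
    ring
  have e3 : √L = Real.exp (Real.log L / 2) := by
    rw [← Real.log_sqrt hL.le, Real.exp_log (Real.sqrt_pos.2 hL)]
  rw [e1, e2, ← Real.exp_add, Real.sqrt_div ha.le, inv_div, e3, mul_div_assoc', Function.comp,
    ← Real.exp_add]
  congr 2
  simp only [← hxdef]
  clear_value x
  simp only [coherenceLevel, ← hLdef]
  ring

theorem tendsto_sq_mul_cap (hp : ∀ n, 1 ≤ p n)
    (hlim : Tendsto (fun n : ℕ => Real.log (n : ℝ) / √(p n)) atTop (𝓝 α)) (y : ℝ)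
    {r : ℕ → ℝ} (hr : ∀ n, ∃ x : UnitSphere (p n), (uniformSphere (p n)).real
      {z | √(coherenceLevel y n / p n) < inner ℝ (x : EuclideanSpace ℝ (Fin (p n))) z} = r n) :
    Tendsto (fun n : ℕ => (n : ℝ) ^ 2 / 2 * r n) atTop
      (𝓝 (1 / (4 * √(2 * Real.pi)) * Real.exp (-(y + 8 * α ^ 2) / 2))) := by
  have hP := tendsto_natCast_dimension hp hlim
  have hpN : Tendsto p atTop atTop := tendsto_natCast_atTop_iff.1 hP
  have hE := tendsto_sq_mul_sqrt_one_sub_pow hp hlim y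
  have hJ := tendsto_sqrt_mul_integral_slopeDensity.comp hpN
  have hpi : √(2 * Real.pi) ≠ 0 := (Real.sqrt_pos.2 (by positivity)).ne'
  have hPinv : Tendsto (fun n => ((p n : ℝ))⁻¹) atTop (𝓝 0) := hP.inv_tendsto_atTop
  have hone : Tendsto (fun n => 1 - 2 * (p n : ℝ)⁻¹) atTop (𝓝 1) := by
    simpa using (tendsto_const_nhds (x := (1 : ℝ))).sub (hPinv.const_mul 2)
  -- The bounds carry `k = p - 2 = p (1 - 2/p)`. The constant `1/4` combines `√(L / a) → 1/2` with
  -- the `1/2` of `n² / 2`; `√(2π)` comes from the normalisation.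
  have hupper : Tendsto (fun n : ℕ => (n : ℝ) ^ 2 * √(1 - coherenceLevel y n / p n) ^ (p n - 1) /
      √(coherenceLevel y n) / 2 / (1 - 2 * (p n : ℝ)⁻¹) /
      (√(p n) * ∫ v, slopeDensity (p n) v)) atTop
      (𝓝 (1 / (4 * √(2 * Real.pi)) * Real.exp (-(y + 8 * α ^ 2) / 2))) := by
    have h := ((hE.div_const 2).div hone one_ne_zero).div hJ hpi
    rw [show Real.exp (-(y + 8 * α ^ 2) / 2) / 2 / 2 / 1 / √(2 * Real.pi) =
      1 / (4 * √(2 * Real.pi)) * Real.exp (-(y + 8 * α ^ 2) / 2) by field_simp; norm_num] at h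
    exact h
  have hcorr : Tendsto (fun n : ℕ => 1 + (coherenceLevel y n)⁻¹ / (1 - 2 * (p n : ℝ)⁻¹)) atTop
      (𝓝 1) := by
    simpa using ((tendsto_coherenceLevel y).inv_tendsto_atTop.div hone one_ne_zero).const_add 1
  have hlower := hupper.div hcorr one_ne_zero
  rw [div_one] at hlower
  have hbounds : ∀ᶠ n : ℕ in atTop,
      (n : ℝ) ^ 2 / 2 * r n ≤ (n : ℝ) ^ 2 * √(1 - coherenceLevel y n / p n) ^ (p n - 1) /
        √(coherenceLevel y n) / 2 / (1 - 2 * (p n : ℝ)⁻¹) /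
        (√(p n) * ∫ v, slopeDensity (p n) v) ∧
      (n : ℝ) ^ 2 * √(1 - coherenceLevel y n / p n) ^ (p n - 1) /
        √(coherenceLevel y n) / 2 / (1 - 2 * (p n : ℝ)⁻¹) /
        (√(p n) * ∫ v, slopeDensity (p n) v) /
        (1 + (coherenceLevel y n)⁻¹ / (1 - 2 * (p n : ℝ)⁻¹)) ≤ (n : ℝ) ^ 2 / 2 * r n := by
    filter_upwards [(tendsto_coherenceLevel y).eventually_gt_atTop 0,
      (tendsto_coherenceLevel_div_dimension hp hlim y).eventually_lt_const one_pos,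
      hpN.eventually_ge_atTop 3] with n ha hx hp3
    obtain ⟨z, hz⟩ := hr n
    -- The dimension occurs in the type of `z`, so it is made a variable before being replaced by `k
    -- + 2`.
    generalize p n = m at *
    generalize coherenceLevel y n = a at *
    obtain ⟨k, rfl⟩ : ∃ k, m = k + 2 := ⟨m - 2, by omega⟩
    have hk : 0 < k := by omega
    have hk' : (0 : ℝ) < k := by exact_mod_cast hk
    have hm : (0 : ℝ) < ((k + 2 : ℕ) : ℝ) := by positivity
    have ht0 : 0 < √(a / ((k + 2 : ℕ) : ℝ)) := Real.sqrt_pos.2 (by positivity)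
    have ht1 : √(a / ((k + 2 : ℕ) : ℝ)) < 1 := by
      rw [Real.sqrt_lt' one_pos, one_pow]
      exact hx
    obtain ⟨hU, hL⟩ := uniformSphere_cap_bounds hk z ht0 ht1
    rw [hz] at hU hL
    rw [Real.sq_sqrt (by positivity)] at hU hL
    have hJ0 : (∫ v, slopeDensity (k + 2) v) ≠ 0 :=
      (integral_slopeDensity_pos (by omega)).ne'
    have hs : 0 < √((k + 2 : ℕ) : ℝ) := Real.sqrt_pos.2 hm
    have hsa : 0 < √a := Real.sqrt_pos.2 ha
    have hss : √((k + 2 : ℕ) : ℝ) ^ 2 = ((k + 2 : ℕ) : ℝ) := Real.sq_sqrt hm.le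
    have hk2 : 1 - 2 * (((k + 2 : ℕ) : ℝ))⁻¹ = k / √((k + 2 : ℕ) : ℝ) ^ 2 := by
      rw [hss]
      push_cast at hm ⊢
      field_simp
      ring
    have hmain : (n : ℝ) ^ 2 * √(1 - a / ((k + 2 : ℕ) : ℝ)) ^ (k + 2 - 1) / √a / 2 /
        (1 - 2 * (((k + 2 : ℕ) : ℝ))⁻¹) / (√((k + 2 : ℕ) : ℝ) * ∫ v, slopeDensity (k + 2) v) =
        (n : ℝ) ^ 2 / 2 * (√(1 - a / ((k + 2 : ℕ) : ℝ)) ^ (k + 1) /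
          (k * √(a / ((k + 2 : ℕ) : ℝ))) / ∫ v, slopeDensity (k + 2) v) := by
      rw [hk2, Real.sqrt_div ha.le, show k + 2 - 1 = k + 1 by omega]
      generalize √(1 - a / ((k + 2 : ℕ) : ℝ)) = w
      generalize √((k + 2 : ℕ) : ℝ) = s at *
      field_simp
    have hcor : 1 + a⁻¹ / (1 - 2 * (((k + 2 : ℕ) : ℝ))⁻¹) =
        1 + 1 / (k * (a / ((k + 2 : ℕ) : ℝ))) := by
      rw [hk2, hss]
      field_simp
    rw [hmain, hcor, mul_div_assoc]
    exact ⟨mul_le_mul_of_nonneg_left hU (by positivity),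
      mul_le_mul_of_nonneg_left hL (by positivity)⟩
  refine tendsto_of_tendsto_of_tendsto_of_le_of_le' hlower hupper ?_ ?_
  · filter_upwards [hbounds] with n hn using hn.2
  · filter_upwards [hbounds] with n hn using hn.1

end

/-! ### Weak convergence from distribution functions, and the limit law -/

/-- Half-open intervals form a π-system containing arbitrarily small neighbourhoods of each point,
so convergence on them suffices; their masses are differences of distribution functions. -/
theorem tendstoInDistribution_of_forall_tendsto_cdf {Ω : ℕ → Type*} [∀ n, MeasurableSpace (Ω n)]
    {P : (n : ℕ) → Measure (Ω n)} [∀ n, IsProbabilityMeasure (P n)] {X : (n : ℕ) → Ω n → ℝ}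
    (hX : ∀ n, AEMeasurable (X n) (P n)) (ν : ProbabilityMeasure ℝ)
    (h : ∀ y, Tendsto (fun n => (P n).real {ω | X n ω ≤ y}) atTop
      (𝓝 (cdf (ν : Measure ℝ) y))) :
    TendstoInDistribution X atTop (id : ℝ → ℝ) P (ν : Measure ℝ) := by
  have hid : AEMeasurable (id : ℝ → ℝ) (ν : Measure ℝ) := aemeasurable_id
  refine ⟨hX, hid, ?_⟩
  have hpi : IsPiSystem {s : Set ℝ | ∃ a b, s = Set.Ioc a b} := by
    rintro _ ⟨a, b, rfl⟩ _ ⟨c, d, rfl⟩ -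
    exact ⟨a ⊔ c, b ⊓ d, Set.Ioc_inter_Ioc⟩
  refine hpi.tendsto_probabilityMeasure_of_tendsto_of_mem ?_ ?_ ?_
  · rintro _ ⟨a, b, rfl⟩
    exact measurableSet_Ioc
  · intro u hu x hx
    obtain ⟨δ, hδ, hball⟩ := Metric.isOpen_iff.1 hu x hx
    refine ⟨Set.Ioc (x - δ / 2) (x + δ / 2), ⟨_, _, rfl⟩,
      Ioc_mem_nhds (by linarith) (by linarith), fun z hz => hball ?_⟩
    rw [Metric.mem_ball, Real.dist_eq, abs_lt]
    constructor <;> linarith [hz.1, hz.2]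
  · rintro _ ⟨a, b, rfl⟩
    -- Using `min a b` also covers the empty interval when `b < a`.
    have hreal : ∀ (m : Measure ℝ) [IsProbabilityMeasure m],
        m.real (Set.Ioc a b) = m.real (Set.Iic b) - m.real (Set.Iic (min a b)) := by
      intro m _
      rw [← measureReal_sdiff (Set.Iic_subset_Iic.2 (min_le_right a b)) measurableSet_Iic]
      congr 1
      ext z
      simp only [Set.mem_Ioc, Set.mem_sdiff, Set.mem_Iic, le_min_iff, not_and, not_le]
      constructor
      · exact fun hz => ⟨hz.2, fun h => absurd h (not_le.2 hz.1)⟩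
      · rintro ⟨h1, h2⟩
        refine ⟨?_, h1⟩
        by_contra hza
        exact absurd (h2 (not_lt.1 hza)) (not_lt.2 h1)
    have hlim : Tendsto (fun n => ((P n).map (X n)).real (Set.Ioc a b)) atTop
        (𝓝 ((ν : Measure ℝ).real (Set.Ioc a b))) := by
      have hm : ∀ n, IsProbabilityMeasure ((P n).map (X n)) := fun n =>
        Measure.isProbabilityMeasure_map (hX n)
      have hev : ∀ n y, ((P n).map (X n)).real (Set.Iic y) = (P n).real {ω | X n ω ≤ y} :=
        fun n y => by
          rw [map_measureReal_apply_of_aemeasurable (hX n) measurableSet_Iic]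
          rfl
      have hcdf : ∀ y, (ν : Measure ℝ).real (Set.Iic y) = cdf (ν : Measure ℝ) y := fun y =>
        (cdf_eq_real _ y).symm
      simp_rw [hreal, hev, hcdf]
      exact (h b).sub (h (min a b))
    rw [← NNReal.tendsto_coe]
    have hν : (⟨(ν : Measure ℝ).map id, Measure.isProbabilityMeasure_map hid⟩ :
        ProbabilityMeasure ℝ) = ν := Subtype.ext Measure.map_id
    rw [hν]
    exact hlim

/-- The Gumbel-type distribution function `exp (-c e^{-(y + d) / 2})`. -/
noncomputable def gumbelStieltjes (c d : ℝ) (hc : 0 < c) : StieltjesFunction ℝ where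
  toFun y := Real.exp (-c * Real.exp (-(y + d) / 2))
  mono' y z hyz := by
    refine Real.exp_le_exp.2 ?_
    have : Real.exp (-(z + d) / 2) ≤ Real.exp (-(y + d) / 2) := Real.exp_le_exp.2 (by linarith)
    nlinarith
  right_continuous' y := by
    refine Continuous.continuousWithinAt ?_
    fun_prop

theorem exists_probabilityMeasure_cdf_eq_gumbel (c d : ℝ) (hc : 0 < c) :
    ∃ ν : ProbabilityMeasure ℝ, (∀ y : ℝ, cdf (ν : Measure ℝ) y =
      Real.exp (-c * Real.exp (-(y + d) / 2))) := by
  have hbot : Tendsto (gumbelStieltjes c d hc) atBot (𝓝 0) := by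
    refine Real.tendsto_exp_atBot.comp ?_
    refine Tendsto.const_mul_atTop_of_neg (by linarith) (Real.tendsto_exp_atTop.comp ?_)
    refine Tendsto.atTop_div_const two_pos (tendsto_neg_atBot_atTop.comp ?_)
    exact tendsto_atBot_add_const_right _ d tendsto_id
  have htop : Tendsto (gumbelStieltjes c d hc) atTop (𝓝 1) := by
    rw [← Real.exp_zero]
    refine (Real.continuous_exp.tendsto 0).comp ?_
    have h : Tendsto (fun y : ℝ => Real.exp (-(y + d) / 2)) atTop (𝓝 0) := by
      refine Real.tendsto_exp_atBot.comp ?_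
      refine Tendsto.atBot_div_const two_pos (tendsto_neg_atTop_atBot.comp ?_)
      exact tendsto_atTop_add_const_right _ d tendsto_id
    simpa using h.const_mul (-c)
  refine ⟨⟨(gumbelStieltjes c d hc).measure, ⟨?_⟩⟩, fun y => ?_⟩
  · rw [StieltjesFunction.measure_univ _ hbot htop, sub_zero, ENNReal.ofReal_one]
  · show cdf (gumbelStieltjes c d hc).measure y = _
    rw [cdf_measure_stieltjesFunction _ hbot htop]
    rfl

/-! ### Extreme angles and signed inner products -/

section
variable {d n : ℕ}

theorem cos_pairAngle (x : Fin n → UnitSphere d) (i j : Fin n) :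
    Real.cos (pairAngle x i j) = inner ℝ (x i : EuclideanSpace ℝ (Fin d)) (x j) := by
  rw [pairAngle, InnerProductGeometry.cos_angle]
  simp

theorem nonempty_pairs (hn : 2 ≤ n) : Nonempty {q : Fin n × Fin n // q.1 < q.2} :=
  ⟨⟨(⟨0, by omega⟩, ⟨1, by omega⟩), by simp [Fin.lt_def]⟩⟩

theorem cos_minAngle_le_iff (hn : 2 ≤ n) (x : Fin n → UnitSphere d) (t : ℝ) :
    Real.cos (minAngle x) ≤ t ↔
      ∀ i j, i < j → inner ℝ (x i : EuclideanSpace ℝ (Fin d)) (x j) ≤ t := by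
  have := nonempty_pairs hn
  obtain ⟨q, hq⟩ := exists_eq_ciInf_of_finite
    (f := fun q : {q : Fin n × Fin n // q.1 < q.2} => pairAngle x q.1.1 q.1.2)
  constructor
  · intro h i j hij
    rw [← cos_pairAngle]
    refine le_trans (Real.cos_le_cos_of_nonneg_of_le_pi ?_
      (InnerProductGeometry.angle_le_pi _ _) ?_) h
    · exact Real.iInf_nonneg fun q => InnerProductGeometry.angle_nonneg _ _
    · exact ciInf_le (Set.finite_range _).bddBelow (⟨(i, j), hij⟩ : {q : Fin n × Fin n // q.1 < q.2})
  · intro h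
    rw [minAngle, ← hq, cos_pairAngle]
    exact h _ _ q.2

theorem neg_cos_maxAngle_le_iff (hn : 2 ≤ n) (x : Fin n → UnitSphere d) (t : ℝ) :
    -Real.cos (maxAngle x) ≤ t ↔
      ∀ i j, i < j → -inner ℝ (x i : EuclideanSpace ℝ (Fin d)) (x j) ≤ t := by
  have := nonempty_pairs hn
  obtain ⟨q, hq⟩ := exists_eq_ciSup_of_finite
    (f := fun q : {q : Fin n × Fin n // q.1 < q.2} => pairAngle x q.1.1 q.1.2)
  constructor
  · intro h i j hij
    rw [← cos_pairAngle]
    refine le_trans (neg_le_neg (Real.cos_le_cos_of_nonneg_of_le_pi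
      (InnerProductGeometry.angle_nonneg _ _) ?_ ?_)) h
    · exact ciSup_le fun q => InnerProductGeometry.angle_le_pi _ _
    · exact le_ciSup (f := fun q : {q : Fin n × Fin n // q.1 < q.2} => pairAngle x q.1.1 q.1.2)
        (Set.finite_range _).bddAbove (⟨(i, j), hij⟩ : {q : Fin n × Fin n // q.1 < q.2})
  · intro h
    rw [maxAngle, ← hq, cos_pairAngle]
    exact h _ _ q.2

theorem measurable_pairAngle (i j : Fin n) :
    Measurable fun x : Fin n → UnitSphere d => pairAngle x i j := by
  unfold pairAngle InnerProductGeometry.angle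
  fun_prop

theorem measurable_minAngle : Measurable (minAngle : (Fin n → UnitSphere d) → ℝ) :=
  Measurable.iInf fun _ => measurable_pairAngle _ _

theorem measurable_maxAngle : Measurable (maxAngle : (Fin n → UnitSphere d) → ℝ) :=
  Measurable.iSup fun _ => measurable_pairAngle _ _

theorem nonempty_unitSphere (hd : 1 ≤ d) : Nonempty (UnitSphere d) :=
  ⟨⟨EuclideanSpace.single ⟨0, hd⟩ 1, by simp⟩⟩

theorem measurableSet_lt_mul_inner (ε t : ℝ) : MeasurableSet {q : UnitSphere d × UnitSphere d |
    t < ε * inner ℝ (q.1 : EuclideanSpace ℝ (Fin d)) q.2} := by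
  refine measurableSet_lt measurable_const ?_
  fun_prop

/-- For `ε = -1` the centre is replaced by its antipode, so the cap estimate serves both signs. -/
theorem exists_cap_eq_signed_cap {ε : ℝ} (hε : ε = 1 ∨ ε = -1) (x : UnitSphere d) (t : ℝ) :
    ∃ x' : UnitSphere d, {z : UnitSphere d | t < ε * inner ℝ (x : EuclideanSpace ℝ (Fin d)) z} =
      {z : UnitSphere d | t < inner ℝ (x' : EuclideanSpace ℝ (Fin d)) z} := by
  rcases hε with rfl | rfl
  · exact ⟨x, by simp⟩
  · exact ⟨-x, by simp⟩

end

/-! ### Convergence of the statistic -/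

section
variable {p : ℕ → ℕ} {α ε : ℝ}

/-- The probability that `ε ⟪x i, x j⟫` stays below the threshold for all pairs. -/
theorem tendsto_measure_no_large_inner (hp : ∀ n, 1 ≤ p n)
    (hlim : Tendsto (fun n : ℕ => Real.log (n : ℝ) / √(p n)) atTop (𝓝 α))
    (hε : ε = 1 ∨ ε = -1) (y : ℝ) :
    Tendsto (fun n => (Measure.pi fun _ : Fin n => uniformSphere (p n)).real
      {x | ∀ i j, i < j → ε * inner ℝ (x i : EuclideanSpace ℝ (Fin (p n))) (x j) ≤
        √(coherenceLevel y n / p n)}) atTop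
      (𝓝 (Real.exp (-(1 / (4 * √(2 * Real.pi))) * Real.exp (-(y + 8 * α ^ 2) / 2)))) := by
  have hprob : ∀ n, IsProbabilityMeasure (uniformSphere (p n)) := fun n =>
    isProbabilityMeasure_uniformSphere (p n) (hp n)
  have hne : ∀ n, Nonempty (UnitSphere (p n)) := fun n => nonempty_unitSphere (hp n)
  let x₀ : ∀ n, UnitSphere (p n) := fun n => Classical.arbitrary _
  have hP := tendsto_natCast_dimension hp hlim
  have hpN : Tendsto p atTop atTop := tendsto_natCast_atTop_iff.1 hP
  have hcap := tendsto_sq_mul_cap hp hlim y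
    (r := fun n => (uniformSphere (p n)).real {z | √(coherenceLevel y n / p n) <
      ε * inner ℝ (x₀ n : EuclideanSpace ℝ (Fin (p n))) z}) fun n => by
      obtain ⟨x', hx'⟩ := exists_cap_eq_signed_cap hε (x₀ n) √(coherenceLevel y n / p n)
      exact ⟨x', by rw [hx']⟩
  -- The slope formula does not mention the centre; it needs dimension at least `2` and threshold
  -- below `1`, hence holds eventually.
  have hr : ∀ᶠ n in atTop, ∀ x : UnitSphere (p n), (uniformSphere (p n)).real
      {z | √(coherenceLevel y n / p n) < ε * inner ℝ (x : EuclideanSpace ℝ (Fin (p n))) z} =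
      (uniformSphere (p n)).real {z | √(coherenceLevel y n / p n) <
        ε * inner ℝ (x₀ n : EuclideanSpace ℝ (Fin (p n))) z} := by
    filter_upwards [hpN.eventually_ge_atTop 2,
      (tendsto_coherenceLevel_div_dimension hp hlim y).eventually_lt_const one_pos] with n hn hx x
    have ht1 : √(coherenceLevel y n / p n) < 1 := by
      rw [Real.sqrt_lt' one_pos, one_pow]
      exact hx
    obtain ⟨x', hx'⟩ := exists_cap_eq_signed_cap hε x √(coherenceLevel y n / p n)
    obtain ⟨x'', hx''⟩ := exists_cap_eq_signed_cap hε (x₀ n) √(coherenceLevel y n / p n)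
    rw [hx', hx'', uniformSphere_real_cap hn x' (Real.sqrt_nonneg _) ht1,
      uniformSphere_real_cap hn x'' (Real.sqrt_nonneg _) ht1]
  have h := tendsto_measure_no_related_pair (fun n => uniformSphere (p n))
    (fun n x z => √(coherenceLevel y n / p n) <
      ε * inner ℝ (x : EuclideanSpace ℝ (Fin (p n))) z)
    (fun n => measurableSet_lt_mul_inner ε _)
    (fun n x z h => by rwa [real_inner_comm]) hr hcap
  simp only [not_lt] at h
  rwa [neg_mul]

/-- Convergence of the distribution functions of `p C² - 4 log n + log log n` when `C` is the
maximum of `ε ⟪x i, x j⟫` over all pairs. -/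
theorem tendsto_cdf_coherence_statistic (hp : ∀ n, 1 ≤ p n)
    (hlim : Tendsto (fun n : ℕ => Real.log (n : ℝ) / √(p n)) atTop (𝓝 α))
    (hε : ε = 1 ∨ ε = -1) {C : (n : ℕ) → (Fin n → UnitSphere (p n)) → ℝ}
    (hC : ∀ n, 2 ≤ n → ∀ x t, C n x ≤ t ↔
      ∀ i j, i < j → ε * inner ℝ (x i : EuclideanSpace ℝ (Fin (p n))) (x j) ≤ t) (y : ℝ) :
    Tendsto (fun n => (Measure.pi fun _ : Fin n => uniformSphere (p n)).real
      {x | (p n : ℝ) * C n x ^ 2 - 4 * Real.log n + Real.log (Real.log n) ≤ y}) atTop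
      (𝓝 (Real.exp (-(1 / (4 * √(2 * Real.pi))) * Real.exp (-(y + 8 * α ^ 2) / 2)))) := by
  have hprob : ∀ n, IsProbabilityMeasure (uniformSphere (p n)) := fun n =>
    isProbabilityMeasure_uniformSphere (p n) (hp n)
  let F : ℝ → ℝ := fun y =>
    Real.exp (-(1 / (4 * √(2 * Real.pi))) * Real.exp (-(y + 8 * α ^ 2) / 2))
  let Q : ∀ n, Measure (Fin n → UnitSphere (p n)) := fun n =>
    Measure.pi fun _ : Fin n => uniformSphere (p n)
  have hA : ∀ y, Tendsto (fun n => (Q n).real {x | C n x ≤ √(coherenceLevel y n / p n)}) atTop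
      (𝓝 (F y)) := by
    intro y
    refine (tendsto_measure_no_large_inner hp hlim hε y).congr' ?_
    filter_upwards [eventually_ge_atTop 2] with n hn
    simp only [hC n hn, Q]
  have hFbot : Tendsto F atBot (𝓝 0) := by
    have hc : 0 < 1 / (4 * √(2 * Real.pi)) := by positivity
    obtain ⟨ν, hν⟩ := exists_probabilityMeasure_cdf_eq_gumbel _ (8 * α ^ 2) hc
    exact (tendsto_cdf_atBot (ν : Measure ℝ)).congr hν
  have hset : ∀ᶠ n in atTop, {x | (p n : ℝ) * C n x ^ 2 - 4 * Real.log n +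
      Real.log (Real.log n) ≤ y} = {x | |C n x| ≤ √(coherenceLevel y n / p n)} := by
    filter_upwards [(tendsto_coherenceLevel y).eventually_gt_atTop 0] with n hn
    have hpn : (0 : ℝ) < p n := by exact_mod_cast hp n
    ext x
    show _ ≤ y ↔ |C n x| ≤ √(coherenceLevel y n / p n)
    rw [Real.le_sqrt (abs_nonneg _) (by positivity), sq_abs, le_div_iff₀ hpn, coherenceLevel]
    constructor <;> intro h <;> linarith
  rw [tendsto_order]
  refine ⟨fun b hb => ?_, fun b hb => ?_⟩
  -- Any `C < -t` is negative, hence below the nonnegative threshold for every level `y'`. Taking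
  -- `y'` far to the left makes the limiting probability `F y'` smaller than the gap `F y - b`.
  · obtain ⟨y', hy'⟩ := ((tendsto_order.1 hFbot).2 (F y - b) (sub_pos.2 hb)).exists
    have hdiff := (hA y).sub (hA y')
    filter_upwards [hset, (tendsto_order.1 hdiff).1 b (by linarith)] with n hn hb'
    rw [hn]
    refine hb'.trans_le (sub_le_iff_le_add.2 ?_)
    refine (measureReal_mono fun x hx => ?_).trans (measureReal_union_le _ _)
    have hx' : C n x ≤ √(coherenceLevel y n / p n) := hx
    by_cases h : -√(coherenceLevel y n / p n) ≤ C n x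
    · exact Or.inl (abs_le.2 ⟨h, hx'⟩)
    · right
      show C n x ≤ _
      have h1 := Real.sqrt_nonneg (coherenceLevel y n / p n)
      have h2 := Real.sqrt_nonneg (coherenceLevel y' n / p n)
      linarith
  · filter_upwards [hset, (tendsto_order.1 (hA y)).2 b hb] with n hn hb'
    rw [hn]
    have hsub : {x | |C n x| ≤ √(coherenceLevel y n / p n)} ⊆
        {x | C n x ≤ √(coherenceLevel y n / p n)} := fun x hx => by
      have hx' : |C n x| ≤ √(coherenceLevel y n / p n) := hx
      exact (le_abs_self (C n x)).trans hx'
    exact (measureReal_mono hsub).trans_lt hb'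

end

theorem corollary1 (p : ℕ → ℕ) (hp : ∀ n, 1 ≤ p n) (α : ℝ) (hα : 0 ≤ α)
    (hlim : Tendsto (fun n : ℕ => Real.log (n : ℝ) / Real.sqrt (p n : ℝ)) atTop (𝓝 α))
    (Ω : ℕ → Type*) [∀ n, MeasurableSpace (Ω n)]
    (P : (n : ℕ) → Measure (Ω n)) [∀ n, IsProbabilityMeasure (P n)]
    (X : (n : ℕ) → Fin n → Ω n → UnitSphere (p n))
    (hlaw : ∀ n i, HasLaw (X n i) (uniformSphere (p n)) (P n))
    (hindep : ∀ n, iIndepFun (X n) (P n)) :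
    ∃ ν : ProbabilityMeasure ℝ,
      (∀ y : ℝ, cdf (ν : Measure ℝ) y =
        Real.exp (-(1 / (4 * Real.sqrt (2 * Real.pi))) *
          Real.exp (-(y + 8 * α ^ 2) / 2))) ∧
      TendstoInDistribution
        (fun (n : ℕ) (ω : Ω n) =>
          (p n : ℝ) * Real.cos (minAngle (fun i => X n i ω)) ^ 2
            - 4 * Real.log (n : ℝ) + Real.log (Real.log (n : ℝ)))
        atTop (id : ℝ → ℝ) P (ν : Measure ℝ) ∧
      TendstoInDistribution
        (fun (n : ℕ) (ω : Ω n) =>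
          (p n : ℝ) * Real.cos (maxAngle (fun i => X n i ω)) ^ 2
            - 4 * Real.log (n : ℝ) + Real.log (Real.log (n : ℝ)))
        atTop (id : ℝ → ℝ) P (ν : Measure ℝ) := by
  obtain ⟨ν, hν⟩ := exists_probabilityMeasure_cdf_eq_gumbel (1 / (4 * √(2 * Real.pi)))
    (8 * α ^ 2) (by positivity)
  have hXm : ∀ n, AEMeasurable (fun ω i => X n i ω) (P n) := fun n =>
    aemeasurable_pi_lambda _ fun i => (hlaw n i).aemeasurable
  -- Only the joint law matters, so everything moves to the product measure.
  have hjoint : ∀ n, (P n).map (fun ω i => X n i ω) =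
      Measure.pi fun _ : Fin n => uniformSphere (p n) := by
    intro n
    rw [(iIndepFun_iff_map_fun_eq_pi_map fun i => (hlaw n i).aemeasurable).1 (hindep n)]
    simp_rw [(hlaw n _).map_eq]
  have key : ∀ (ε : ℝ) (_ : ε = 1 ∨ ε = -1) (C : (n : ℕ) → (Fin n → UnitSphere (p n)) → ℝ)
      (_ : ∀ n, Measurable (C n)) (_ : ∀ n, 2 ≤ n → ∀ x t, C n x ≤ t ↔
        ∀ i j, i < j → ε * inner ℝ (x i : EuclideanSpace ℝ (Fin (p n))) (x j) ≤ t),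
      TendstoInDistribution (fun (n : ℕ) (ω : Ω n) => (p n : ℝ) * C n (fun i => X n i ω) ^ 2
        - 4 * Real.log (n : ℝ) + Real.log (Real.log (n : ℝ))) atTop (id : ℝ → ℝ) P
        (ν : Measure ℝ) := by
    intro ε hε C hCm hC
    have hstat : ∀ n, Measurable fun x => (p n : ℝ) * C n x ^ 2 - 4 * Real.log (n : ℝ) +
        Real.log (Real.log (n : ℝ)) := fun n =>
      ((((hCm n).pow_const 2).const_mul _).sub_const _).add_const _
    refine tendstoInDistribution_of_forall_tendsto_cdf
      (fun n => (hstat n).comp_aemeasurable (hXm n)) ν fun y => ?_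
    rw [hν]
    refine (tendsto_cdf_coherence_statistic hp hlim hε hC y).congr fun n => ?_
    rw [← hjoint, map_measureReal_apply_of_aemeasurable (hXm n)
      (measurableSet_le (hstat n) measurable_const)]
    rfl
  refine ⟨ν, hν, ?_, ?_⟩
  · refine key 1 (Or.inl rfl) (fun n x => Real.cos (minAngle x))
      (fun n => Real.measurable_cos.comp measurable_minAngle) fun n hn x t => ?_
    simp only [one_mul]
    exact cos_minAngle_le_iff hn x t
  · have h := key (-1) (Or.inr rfl) (fun n x => -Real.cos (maxAngle x))
      (fun n => (Real.measurable_cos.comp measurable_maxAngle).neg) fun n hn x t => by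
        simp only [neg_one_mul]
        exact neg_cos_maxAngle_le_iff hn x t
    simpa only [neg_sq] using h
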